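/- Let $p$ be a prime and let $R$ be a $C_p$-Tambara functor, that is, commutative rings $R(C_p/e)$ (with an action of $C_p$ by ring automorphisms) and $R(C_p/C_p)$ with a restriction $\mathrm{Res}\colon R(C_p/C_p)\to R(C_p/e)$, a transfer $\mathrm{Tr}$ and a norm $\mathrm{Nm}\colon R(C_p/e)\to R(C_p/C_p)$ satisfying the usual axioms (in particular Frobenius reciprocity, Tambara reciprocity and $\mathrm{Nm}(0)=0$). The ghost of $R$ is the $C_p$-Tambara functor $\mathrm{ghost}(R)$ with $$\mathrm{ghost}(R)(C_p/e)=R(C_p/e),\qquad \mathrm{ghost}(R)(C_p/C_p)=R(C_p/e)^{C_p}\times R(C_p/C_p)/\mathrm{im}(\mathrm{Tr}),$$ restriction $(x,y)\mapsto x$, transfer $a\mapsto(\sum_{g} ga,\,0)$ and norm $a\mapsto(\prod_{g} ga,\,[\mathrm{Nm}(a)])$. For a commutative ring $A$, the coinduction $\mathrm{CoInd}_e^{C_p}A$ is the $C_p$-Tambara functor with level $C_p/e$ the ring of functions $C_p\to A$ (with the translation action), level $C_p/C_p$ the ring $A$, restriction the diagonal, transfer the sum of the values and norm the product of the values. The canonical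 map $$\mathrm{ghost}(R)\longrightarrow \mathrm{CoInd}_e^{C_p}R(C_p/e)$$ is $a\mapsto(g\mapsto ga)$ on level $C_p/e$ and the restriction $(x,y)\mapsto x$ on level $C_p/C_p$. A morphism $R\to S$ of $C_p$-Tambara functors is étale if (i) it is finitely presented, i.e. $S$ is isomorphic as an $R$-algebra to the quotient of a polynomial $R$-algebra on finitely many generators (each on level $C_p/e$ or $C_p/C_p$) by a finitely generated Tambara ideal; (ii) it is flat, i.e. $-\mathbin{\square}_R S$ is an exact functor on $R$-modules; and (iii) the genuine Kähler differentials $I/I^{>1}$ vanish, where $I$ is the kernel of the multiplication $S\mathbin{\square}_R S\to S$ and $I^{>1}$ is the Tambara ideal generated by all products of two elements of $I$ on the same level and all norms of elements of $I(C_p/e)$. The Nakaoka spectrum $\mathrm{Spec}(R)$ is the set of prime Tambara ideals of $R$ (proper ideals $\mathfrak p$ such that $I\cdot J\subseteq\mathfrak p$ implies $I\subseteq\mathfrak p$ or $J\subseteq\mathfrak p$), with the topology whose closed sets are generated by the sets $V(I)=\{\mathfrak p : I\subseteq\mathfrak p\}$ for all Tambara ideals $I$; a morphism induces a map of spectra by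 taking preimages. Suppose that the transfer $\mathrm{Tr}\colon R(C_p/e)\to R(C_p/C_p)$ is not surjective. Then the canonical map $\mathrm{ghost}(R)\to\mathrm{CoInd}_e^{C_p}R(C_p/e)$ is étale, but the induced map of Nakaoka spectra $\mathrm{Spec}(\mathrm{CoInd}_e^{C_p}R(C_p/e))\to\mathrm{Spec}(\mathrm{ghost}(R))$ is not open. -/

import Mathlib

open scoped Pointwise TensorProduct

universe u

/-- The cyclic group `C_p` of order `p`, written multiplicatively. -/
abbrev Cp (p : ℕ) : Type := Multiplicative (ZMod p)

/-! ### Orbits of mixed subsets of `C_p` -/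

/-- The subsets of `C_p` that are neither empty nor everything. -/
def MixedSubset (p : ℕ) [Fact p.Prime] : Type :=
  {U : Finset (Cp p) // U.Nonempty ∧ U ≠ Finset.univ}

namespace MixedSubset

variable {p : ℕ} [Fact p.Prime]

/-- `C_p` acts on its mixed subsets by translation. -/
instance : MulAction (Cp p) (MixedSubset p) where
  smul g U := ⟨g • U.1, U.2.1.smul_finset, fun h => U.2.2 (by
    have h' : g • U.1 = g • Finset.univ := by rw [h, Finset.smul_finset_univ]
    exact smul_left_cancel g h')⟩
  one_smul U := Subtype.ext (one_smul (Cp p) U.1)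
  mul_smul g h U := Subtype.ext (mul_smul g h U.1)

theorem coe_smul (g : Cp p) (U : MixedSubset p) : (g • U).1 = g • U.1 := rfl

instance : Finite (MixedSubset p) := Subtype.finite

theorem stabilizer_eq_bot (U : MixedSubset p) : MulAction.stabilizer (Cp p) U = ⊥ := by
  have : Fact (Nat.card (Cp p)).Prime := ⟨by
    rw [Nat.card_eq_fintype_card, Fintype.card_multiplicative, ZMod.card]; exact Fact.out⟩
  rcases Subgroup.eq_bot_or_eq_top_of_prime_card (MulAction.stabilizer (Cp p) U) with h | h
  · exact h
  · exfalso
    obtain ⟨x, hx⟩ := U.2.1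
    refine U.2.2 (Finset.eq_univ_iff_forall.2 fun y => ?_)
    have hm : y * x⁻¹ ∈ MulAction.stabilizer (Cp p) U := h ▸ Subgroup.mem_top _
    have h1 : (y * x⁻¹) • U.1 = U.1 :=
      congrArg (fun V : MixedSubset p => V.1) (MulAction.mem_stabilizer_iff.1 hm)
    have h2 : (y * x⁻¹) • x ∈ (y * x⁻¹) • U.1 := Finset.smul_mem_smul_finset hx
    rw [h1] at h2
    simpa using h2

end MixedSubset

/-- The orbits of the mixed subsets of `C_p` under translation. -/
abbrev MixedOrbit (p : ℕ) [Fact p.Prime] : Type :=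
  MulAction.orbitRel.Quotient (Cp p) (MixedSubset p)

noncomputable instance (p : ℕ) [Fact p.Prime] : Fintype (MixedOrbit p) := Fintype.ofFinite _

/-- A subset of `C_p` representing the orbit `ω`. -/
noncomputable def MixedOrbit.rep {p : ℕ} [Fact p.Prime] (ω : MixedOrbit p) : Finset (Cp p) :=
  (Quotient.out ω : MixedSubset p).1

theorem MixedOrbit.sum_all {p : ℕ} [Fact p.Prime] {A : Type*} [AddCommMonoid A]
    (F : Finset (Cp p) → A) :
    ∑ U : Finset (Cp p), F U =
      F Finset.univ + F ∅ + ∑ ω : MixedOrbit p, ∑ g : Cp p, F (g • ω.rep) := by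
  classical
  let _ : Fintype (MixedSubset p) := Fintype.ofFinite _
  have e1 : ∑ ω : MixedOrbit p, ∑ g : Cp p, F (g • ω.rep) = ∑ U : MixedSubset p, F U.1 := by
    rw [← Fintype.sum_prod_type']
    refine Fintype.sum_bijective
      (fun x : MixedOrbit p × Cp p => x.2 • (Quotient.out x.1 : MixedSubset p)) ⟨?_, ?_⟩ _ _ ?_
    · rintro ⟨ω, g⟩ ⟨ω', g'⟩ h
      simp only at h
      have hω : ω = ω' := by
        rw [← Quotient.out_eq ω, ← Quotient.out_eq ω']
        refine Quotient.sound ?_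
        change _ ∈ MulAction.orbit _ _
        refine ⟨g⁻¹ * g', ?_⟩
        simp only [mul_smul, ← h, inv_smul_smul]
      subst hω
      have : g⁻¹ * g' ∈ MulAction.stabilizer (Cp p) (Quotient.out ω : MixedSubset p) := by
        rw [MulAction.mem_stabilizer_iff, mul_smul, ← h, inv_smul_smul]
      rw [MixedSubset.stabilizer_eq_bot, Subgroup.mem_bot, inv_mul_eq_one] at this
      rw [this]
    · intro U
      have : (Quotient.mk (MulAction.orbitRel (Cp p) (MixedSubset p)) U).out ∈
          MulAction.orbit (Cp p) U :=
        Quotient.exact (Quotient.out_eq (Quotient.mk (MulAction.orbitRel (Cp p) _) U))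
      obtain ⟨g, hg⟩ := this
      refine ⟨(Quotient.mk _ U, g⁻¹), ?_⟩
      simp only
      rw [← hg]
      exact inv_smul_smul g U
    · rintro ⟨ω, g⟩
      rfl
  have e2 : ∑ U : MixedSubset p, F U.1 =
      ∑ U ∈ Finset.univ.filter (fun U : Finset (Cp p) => U.Nonempty ∧ U ≠ Finset.univ), F U :=
    (Finset.sum_subtype _ (by simp) F).symm
  have e3 : (Finset.univ.filter
      (fun U : Finset (Cp p) => ¬ (U.Nonempty ∧ U ≠ Finset.univ))) = {Finset.univ, ∅} := by
    ext U
    simp only [Finset.mem_filter, Finset.mem_univ, true_and, Finset.mem_insert,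
      Finset.mem_singleton, ← Finset.not_nonempty_iff_eq_empty]
    tauto
  rw [e1, e2, ← Finset.sum_filter_not_add_sum_filter Finset.univ
    (fun U : Finset (Cp p) => U.Nonempty ∧ U ≠ Finset.univ) F, e3,
    Finset.sum_pair Finset.univ_nonempty.ne_empty]

/-! ### `C_p`-Tambara functors -/

/-- A `C_p`-Tambara functor `R` (with values on the transitive `C_p`-sets), given by its Lewis
diagram: the commutative rings `bot = R(C_p/e)`, on which the Weyl group `C_p` acts by ring
automorphisms, and `top = R(C_p/C_p)`, with the restriction, the transfer and the norm between
them. The last field is the Tambara reciprocity for the norm of a sum; by `tr_smul` its summands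
do not depend on the chosen representatives of the orbits. -/
structure CpTambara (p : ℕ) [Fact p.Prime] : Type (u + 1) where
  bot : Type u
  top : Type u
  [ringBot : CommRing bot]
  [ringTop : CommRing top]
  [weyl : MulSemiringAction (Cp p) bot]
  res : top →+* bot
  tr : bot →+ top
  nm : bot →* top
  smul_res : ∀ (g : Cp p) (x : top), g • res x = res x
  tr_smul : ∀ (g : Cp p) (a : bot), tr (g • a) = tr a
  nm_smul : ∀ (g : Cp p) (a : bot), nm (g • a) = nm a
  nm_zero : nm 0 = 0
  res_tr : ∀ a : bot, res (tr a) = ∑ g : Cp p, g • a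
  res_nm : ∀ a : bot, res (nm a) = ∏ g : Cp p, g • a
  tr_mul_res : ∀ (a : bot) (x : top), tr (a * res x) = tr a * x
  nm_add : ∀ a b : bot, nm (a + b) = nm a + nm b +
    ∑ ω : MixedOrbit p, tr ((∏ g ∈ ω.rep, g • a) * ∏ g ∈ (ω.rep)ᶜ, g • b)

attribute [instance] CpTambara.ringBot CpTambara.ringTop CpTambara.weyl

namespace CpTambara

variable {p : ℕ} [Fact p.Prime]

/-- The expansion of a product of sums indexed by `C_p`. -/
theorem prod_add_eq {A : Type*} [CommRing A] (a b : Cp p → A) :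
    ∏ g, (a g + b g) = ∏ g, a g + ∏ g, b g +
      ∑ ω : MixedOrbit p, ∑ h : Cp p,
        (∏ g ∈ ω.rep, a (h * g)) * ∏ g ∈ (ω.rep)ᶜ, b (h * g) := by
  classical
  rw [Finset.prod_add, Finset.powerset_univ,
    MixedOrbit.sum_all (fun U => (∏ i ∈ U, a i) * ∏ i ∈ Finset.univ \ U, b i)]
  congr 1
  · simp
  · refine Finset.sum_congr rfl fun ω _ => Finset.sum_congr rfl fun h _ => ?_
    congr 1
    · rw [Finset.smul_finset_def, Finset.prod_image (fun _ _ _ _ h' => smul_left_cancel h h')]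
      rfl
    · have hc : Finset.univ \ h • ω.rep = h • (ω.rep)ᶜ := by
        rw [Finset.compl_eq_univ_sdiff, Finset.smul_finset_sdiff, Finset.smul_finset_univ]
      rw [hc, Finset.smul_finset_def,
        Finset.prod_image (fun _ _ _ _ h' => smul_left_cancel h h')]
      rfl

/-- A morphism of `C_p`-Tambara functors. -/
@[ext]
structure Hom (R S : CpTambara.{u} p) : Type u where
  bot : R.bot →+* S.bot
  top : R.top →+* S.top
  map_smul : ∀ (g : Cp p) (a : R.bot), bot (g • a) = g • bot a
  map_res : ∀ x : R.top, bot (R.res x) = S.res (top x)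
  map_tr : ∀ a : R.bot, top (R.tr a) = S.tr (bot a)
  map_nm : ∀ a : R.bot, top (R.nm a) = S.nm (bot a)

/-- The composite of two morphisms. -/
def Hom.comp {R S T : CpTambara.{u} p} (g : Hom S T) (f : Hom R S) : Hom R T where
  bot := g.bot.comp f.bot
  top := g.top.comp f.top
  map_smul h a := by simp [f.map_smul, g.map_smul]
  map_res x := by simp [f.map_res, g.map_res]
  map_tr a := by simp [f.map_tr, g.map_tr]
  map_nm a := by simp [f.map_nm, g.map_nm]

/-- The identity morphism. -/
def Hom.id (R : CpTambara.{u} p) : Hom R R where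
  bot := RingHom.id _
  top := RingHom.id _
  map_smul _ _ := rfl
  map_res _ := rfl
  map_tr _ := rfl
  map_nm _ := rfl

/-! ### Ideals and the Nakaoka spectrum -/

/-- A Tambara ideal of `R`. -/
@[ext]
structure TIdeal (R : CpTambara.{u} p) : Type u where
  bot : Ideal R.bot
  top : Ideal R.top
  smul_mem : ∀ (g : Cp p) {a : R.bot}, a ∈ bot → g • a ∈ bot
  res_mem : ∀ {x : R.top}, x ∈ top → R.res x ∈ bot
  tr_mem : ∀ {a : R.bot}, a ∈ bot → R.tr a ∈ top
  nm_mem : ∀ {a : R.bot}, a ∈ bot → R.nm a ∈ top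

namespace TIdeal

variable {R S : CpTambara.{u} p}

instance : LE (TIdeal R) := ⟨fun I J => I.bot ≤ J.bot ∧ I.top ≤ J.top⟩

instance : Top (TIdeal R) := ⟨{
  bot := ⊤
  top := ⊤
  smul_mem := fun _ _ _ => trivial
  res_mem := fun _ => trivial
  tr_mem := fun _ => trivial
  nm_mem := fun _ => trivial }⟩

instance : Bot (TIdeal R) := ⟨{
  bot := ⊥
  top := ⊥
  smul_mem := fun g a h => by rw [Ideal.mem_bot] at h ⊢; rw [h, smul_zero]
  res_mem := fun h => by rw [Ideal.mem_bot] at h ⊢; rw [h, map_zero]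
  tr_mem := fun h => by rw [Ideal.mem_bot] at h ⊢; rw [h, map_zero]
  nm_mem := fun h => by rw [Ideal.mem_bot] at h ⊢; rw [h, R.nm_zero] }⟩

/-- The Tambara ideal generated by a set of elements at each level: the intersection of all
Tambara ideals that contain them. -/
def span (s : Set R.bot) (t : Set R.top) : TIdeal R where
  bot := ⨅ (I : TIdeal R) (_ : s ⊆ I.bot ∧ t ⊆ I.top), I.bot
  top := ⨅ (I : TIdeal R) (_ : s ⊆ I.bot ∧ t ⊆ I.top), I.top
  smul_mem g a h := by
    simp only [Submodule.mem_iInf] at h ⊢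
    exact fun I hI => I.smul_mem g (h I hI)
  res_mem h := by
    simp only [Submodule.mem_iInf] at h ⊢
    exact fun I hI => I.res_mem (h I hI)
  tr_mem h := by
    simp only [Submodule.mem_iInf] at h ⊢
    exact fun I hI => I.tr_mem (h I hI)
  nm_mem h := by
    simp only [Submodule.mem_iInf] at h ⊢
    exact fun I hI => I.nm_mem (h I hI)

theorem span_le {s : Set R.bot} {t : Set R.top} {I : TIdeal R} :
    span s t ≤ I ↔ s ⊆ I.bot ∧ t ⊆ I.top := by
  constructor
  · intro h
    refine ⟨fun x hx => h.1 ?_, fun x hx => h.2 ?_⟩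
    · simp only [span, Submodule.mem_iInf]
      exact fun J hJ => hJ.1 hx
    · simp only [span, Submodule.mem_iInf]
      exact fun J hJ => hJ.2 hx
  · intro h
    exact ⟨iInf₂_le I h, iInf₂_le I h⟩

/-- `I` is generated by finitely many elements. -/
def FG (I : TIdeal R) : Prop :=
  ∃ (s : Finset R.bot) (t : Finset R.top), I = span (s : Set R.bot) (t : Set R.top)

/-- The product of two Tambara ideals. -/
instance : Mul (TIdeal R) :=
  ⟨fun I J => span (Set.image2 (fun a b => a * b) (I.bot : Set R.bot) (J.bot : Set R.bot))
    (Set.image2 (fun x y => x * y) (I.top : Set R.top) (J.top : Set R.top))⟩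

theorem mul_le {I J K : TIdeal R} : I * J ≤ K ↔
    (∀ a ∈ I.bot, ∀ b ∈ J.bot, a * b ∈ K.bot) ∧ (∀ x ∈ I.top, ∀ y ∈ J.top, x * y ∈ K.top) := by
  change span _ _ ≤ K ↔ _
  rw [span_le, Set.image2_subset_iff, Set.image2_subset_iff]
  rfl

/-- A prime Tambara ideal. -/
structure IsPrime (P : TIdeal R) : Prop where
  ne_top : P ≠ ⊤
  le_or_le : ∀ I J : TIdeal R, I * J ≤ P → I ≤ P ∨ J ≤ P

/-- The preimage of a Tambara ideal under a morphism. -/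
def comap (f : Hom R S) (I : TIdeal S) : TIdeal R where
  bot := I.bot.comap f.bot
  top := I.top.comap f.top
  smul_mem g a h := by
    rw [Ideal.mem_comap, f.map_smul]; exact I.smul_mem g h
  res_mem h := by
    rw [Ideal.mem_comap, f.map_res]; exact I.res_mem h
  tr_mem h := by
    rw [Ideal.mem_comap, f.map_tr]; exact I.tr_mem h
  nm_mem h := by
    rw [Ideal.mem_comap, f.map_nm]; exact I.nm_mem h

/-- The image under the transfer of an ideal of the bottom ring, as an ideal of the top ring. -/
def trIdeal (I : Ideal R.bot) : Ideal R.top where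
  carrier := {x | ∃ a ∈ I, R.tr a = x}
  add_mem' := by
    rintro _ _ ⟨a, ha, rfl⟩ ⟨b, hb, rfl⟩
    exact ⟨a + b, I.add_mem ha hb, map_add _ _ _⟩
  zero_mem' := ⟨0, I.zero_mem, map_zero _⟩
  smul_mem' := by
    rintro c _ ⟨a, ha, rfl⟩
    exact ⟨a * R.res c, I.mul_mem_right _ ha, by rw [R.tr_mul_res, smul_eq_mul, mul_comm]⟩

/-- The Tambara ideal of `S` generated by the image of a Tambara ideal of `R`. -/
def map (f : Hom R S) (I : TIdeal R) : TIdeal S where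
  bot := I.bot.map f.bot
  top := I.top.map f.top ⊔ trIdeal (I.bot.map f.bot)
  smul_mem g a h := by
    refine Submodule.span_induction (p := fun a _ => g • a ∈ I.bot.map f.bot) ?_ ?_ ?_ ?_ h
    · rintro _ ⟨b, hb, rfl⟩
      rw [← f.map_smul]
      exact Ideal.mem_map_of_mem _ (I.smul_mem g hb)
    · simp
    · intro a b _ _ ha hb
      rw [smul_add]
      exact Ideal.add_mem _ ha hb
    · intro c a _ ha
      rw [smul_eq_mul, smul_mul']
      exact Ideal.mul_mem_left _ _ ha
  res_mem h := by
    refine (sup_le (c := (I.bot.map f.bot).comap S.res) ?_ ?_) h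
    · rw [Ideal.map_le_iff_le_comap]
      intro y hy
      rw [Ideal.mem_comap, Ideal.mem_comap, ← f.map_res]
      exact Ideal.mem_map_of_mem _ (I.res_mem hy)
    · rintro _ ⟨a, ha, rfl⟩
      rw [Ideal.mem_comap, S.res_tr]
      refine Ideal.sum_mem _ fun g _ => ?_
      refine Submodule.span_induction (p := fun a _ => g • a ∈ I.bot.map f.bot) ?_ ?_ ?_ ?_ ha
      · rintro _ ⟨b, hb, rfl⟩
        rw [← f.map_smul]
        exact Ideal.mem_map_of_mem _ (I.smul_mem g hb)
      · simp
      · intro a b _ _ ha hb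
        rw [smul_add]
        exact Ideal.add_mem _ ha hb
      · intro c a _ ha
        rw [smul_eq_mul, smul_mul']
        exact Ideal.mul_mem_left _ _ ha
  tr_mem h := Ideal.mem_sup_right ⟨_, h, rfl⟩
  nm_mem h := by
    have key : ∀ g : Cp p, ∀ a ∈ I.bot.map f.bot, g • a ∈ I.bot.map f.bot := by
      intro g a ha
      refine Submodule.span_induction (p := fun a _ => g • a ∈ I.bot.map f.bot) ?_ ?_ ?_ ?_ ha
      · rintro _ ⟨b, hb, rfl⟩
        rw [← f.map_smul]
        exact Ideal.mem_map_of_mem _ (I.smul_mem g hb)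
      · simp
      · intro a b _ _ ha hb
        rw [smul_add]
        exact Ideal.add_mem _ ha hb
      · intro c a _ ha
        rw [smul_eq_mul, smul_mul']
        exact Ideal.mul_mem_left _ _ ha
    refine Submodule.span_induction
      (p := fun a _ => S.nm a ∈ I.top.map f.top ⊔ trIdeal (I.bot.map f.bot)) ?_ ?_ ?_ ?_ h
    · rintro _ ⟨b, hb, rfl⟩
      rw [← f.map_nm]
      exact Ideal.mem_sup_left (Ideal.mem_map_of_mem _ (I.nm_mem hb))
    · rw [S.nm_zero]
      exact Ideal.zero_mem _
    · intro a b ha' _ ha hb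
      rw [S.nm_add]
      refine Ideal.add_mem _ (Ideal.add_mem _ ha hb) (Ideal.sum_mem _ fun ω _ => ?_)
      refine Ideal.mem_sup_right ⟨_, ?_, rfl⟩
      refine Ideal.mul_mem_right _ _ ?_
      obtain ⟨g, hg⟩ := (Quotient.out ω : MixedSubset p).2.1
      exact Ideal.prod_mem _ hg (key g a ha')
    · intro c a _ ha
      rw [smul_eq_mul, map_mul]
      exact Ideal.mul_mem_left _ _ ha

theorem map_le_iff {f : Hom R S} {I : TIdeal R} {J : TIdeal S} :
    map f I ≤ J ↔ I ≤ comap f J := by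
  constructor
  · rintro ⟨h1, h2⟩
    exact ⟨Ideal.map_le_iff_le_comap.1 h1, Ideal.map_le_iff_le_comap.1 (le_sup_left.trans h2)⟩
  · rintro ⟨h1, h2⟩
    have h3 := Ideal.map_le_iff_le_comap.2 h1
    refine ⟨h3, sup_le (Ideal.map_le_iff_le_comap.2 h2) ?_⟩
    rintro _ ⟨a, ha, rfl⟩
    exact J.tr_mem (h3 ha)

theorem map_mul_map_le {f : Hom R S} {I J : TIdeal R} {K : TIdeal S}
    (h : I * J ≤ comap f K) : map f I * map f J ≤ K := by
  obtain ⟨h1, h2⟩ := mul_le.1 h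
  have hb : I.bot.map f.bot * J.bot.map f.bot ≤ K.bot := by
    rw [← Ideal.map_mul, Ideal.map_le_iff_le_comap, Ideal.mul_le]
    exact h1
  have ht : I.top.map f.top * J.top.map f.top ≤ K.top := by
    rw [← Ideal.map_mul, Ideal.map_le_iff_le_comap, Ideal.mul_le]
    exact h2
  refine mul_le.2 ⟨fun a ha b hb' => hb (Ideal.mul_mem_mul ha hb'), ?_⟩
  have aux1 : ∀ a ∈ (map f I).bot, ∀ y ∈ (map f J).top, S.tr a * y ∈ K.top := by
    intro a ha y hy
    rw [← S.tr_mul_res]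
    exact K.tr_mem (hb (Ideal.mul_mem_mul ha ((map f J).res_mem hy)))
  have aux2 : ∀ x ∈ (map f I).top, ∀ b ∈ (map f J).bot, x * S.tr b ∈ K.top := by
    intro x hx b hb'
    rw [mul_comm, ← S.tr_mul_res, mul_comm]
    exact K.tr_mem (hb (Ideal.mul_mem_mul ((map f I).res_mem hx) hb'))
  intro x hx y hy
  obtain ⟨x1, hx1, x2, ⟨a, ha, rfl⟩, rfl⟩ := Submodule.mem_sup.1 hx
  obtain ⟨y1, hy1, y2, ⟨b, hb', rfl⟩, rfl⟩ := Submodule.mem_sup.1 hy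
  rw [add_mul, mul_add]
  exact K.top.add_mem (K.top.add_mem (ht (Ideal.mul_mem_mul hx1 hy1))
    (aux2 x1 (Ideal.mem_sup_left hx1) b hb')) (aux1 a ha _ hy)

theorem IsPrime.comap {f : Hom R S} {P : TIdeal S} (hP : P.IsPrime) : (comap f P).IsPrime where
  ne_top h := hP.ne_top <| by
    have hb : (1 : R.bot) ∈ (TIdeal.comap f P).bot := h ▸ (trivial : (1 : R.bot) ∈ (⊤ : Ideal _))
    have ht : (1 : R.top) ∈ (TIdeal.comap f P).top := h ▸ (trivial : (1 : R.top) ∈ (⊤ : Ideal _))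
    have hb' : f.bot 1 ∈ P.bot := hb
    have ht' : f.top 1 ∈ P.top := ht
    rw [map_one] at hb' ht'
    exact TIdeal.ext ((Ideal.eq_top_iff_one _).2 hb') ((Ideal.eq_top_iff_one _).2 ht')
  le_or_le I J h := by
    rcases hP.le_or_le _ _ (map_mul_map_le h) with h | h
    · exact Or.inl (map_le_iff.1 h)
    · exact Or.inr (map_le_iff.1 h)

end TIdeal

/-- The kernel of a morphism. -/
def Hom.ker {R S : CpTambara.{u} p} (f : Hom R S) : TIdeal R := TIdeal.comap f ⊥

/-- The points of the Nakaoka spectrum of `R`. -/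
def Spec (R : CpTambara.{u} p) : Type u := {P : TIdeal R // P.IsPrime}

/-- The set of the prime ideals that contain `I`. -/
def Spec.zeroLocus {R : CpTambara.{u} p} (I : TIdeal R) : Set (Spec R) := {P | I ≤ P.1}

/-- The topology whose closed subsets are generated by the sets `zeroLocus I`. -/
instance (R : CpTambara.{u} p) : TopologicalSpace (Spec R) :=
  TopologicalSpace.generateFrom {U | ∃ I : TIdeal R, U = (Spec.zeroLocus I)ᶜ}

/-- The map of Nakaoka spectra induced by a morphism. -/
def Spec.map {R S : CpTambara.{u} p} (f : Hom R S) (P : Spec S) : Spec R :=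
  ⟨TIdeal.comap f P.1, P.2.comap⟩

/-! ### The ghost and coinduction from the trivial group -/

/-- The ideal of `R(C_p/C_p)` of all transfers. -/
def transferIdeal (R : CpTambara.{u} p) : Ideal R.top := TIdeal.trIdeal (⊤ : Ideal R.bot)

theorem tr_mem_transferIdeal (R : CpTambara.{u} p) (a : R.bot) : R.tr a ∈ R.transferIdeal :=
  ⟨a, trivial, rfl⟩

/-- The subring `R(C_p/e)^{C_p}` of fixed points. -/
def fixedPoints (R : CpTambara.{u} p) : Subring R.bot where
  carrier := {a | ∀ g : Cp p, g • a = a}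
  mul_mem' ha hb g := by rw [smul_mul', ha, hb]
  one_mem' g := smul_one g
  add_mem' ha hb g := by rw [smul_add, ha, hb]
  zero_mem' g := smul_zero g
  neg_mem' ha g := by rw [smul_neg, ha]

theorem sum_smul_mem (R : CpTambara.{u} p) (a : R.bot) :
    ∑ g : Cp p, g • a ∈ R.fixedPoints := fun h => by
  rw [← R.res_tr, R.smul_res]

theorem prod_smul_mem (R : CpTambara.{u} p) (a : R.bot) :
    ∏ g : Cp p, g • a ∈ R.fixedPoints := fun h => by
  rw [← R.res_nm, R.smul_res]

/-- The ghost of `R`: its levels are `R(C_p/e)` and `R(C_p/e)^{C_p} × R(C_p/C_p)/Tr`; the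
restriction is the first projection, the transfer is `a ↦ (∑ g • a, 0)` and the norm is
`a ↦ (∏ g • a, Nm a)`. -/
def ghost (R : CpTambara.{u} p) : CpTambara.{u} p where
  bot := R.bot
  top := R.fixedPoints × (R.top ⧸ R.transferIdeal)
  res := R.fixedPoints.subtype.comp (RingHom.fst _ _)
  tr := {
    toFun := fun a => (⟨∑ g : Cp p, g • a, R.sum_smul_mem a⟩, 0)
    map_zero' := by
      refine Prod.ext (Subtype.ext ?_) rfl
      simp
    map_add' := fun a b => by
      refine Prod.ext (Subtype.ext ?_) (add_zero _).symm
      simp [Finset.sum_add_distrib] }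
  nm := {
    toFun := fun a => (⟨∏ g : Cp p, g • a, R.prod_smul_mem a⟩,
      Ideal.Quotient.mk R.transferIdeal (R.nm a))
    map_one' := by
      refine Prod.ext (Subtype.ext ?_) ?_
      · simp
      · simp
    map_mul' := fun a b => by
      refine Prod.ext (Subtype.ext ?_) ?_
      · simp [Finset.prod_mul_distrib, smul_mul']
      · simp }
  smul_res g x := x.1.2 g
  tr_smul g a := by
    refine Prod.ext (Subtype.ext ?_) rfl
    change ∑ h : Cp p, h • g • a = ∑ h : Cp p, h • a
    rw [← R.res_tr, ← R.res_tr, R.tr_smul]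
  nm_smul g a := by
    refine Prod.ext (Subtype.ext ?_) ?_
    · change ∏ h : Cp p, h • g • a = ∏ h : Cp p, h • a
      rw [← R.res_nm, ← R.res_nm, R.nm_smul]
    · change Ideal.Quotient.mk _ (R.nm (g • a)) = Ideal.Quotient.mk _ (R.nm a)
      rw [R.nm_smul]
  nm_zero := by
    refine Prod.ext (Subtype.ext ?_) ?_
    · change ∏ h : Cp p, h • (0 : R.bot) = 0
      rw [← R.res_nm, R.nm_zero, map_zero]
    · change Ideal.Quotient.mk _ (R.nm 0) = 0
      rw [R.nm_zero, map_zero]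
  res_tr a := rfl
  res_nm a := rfl
  tr_mul_res a x := by
    refine Prod.ext (Subtype.ext ?_) (zero_mul _).symm
    change ∑ g : Cp p, g • (a * (x.1 : R.bot)) = (∑ g : Cp p, g • a) * (x.1 : R.bot)
    rw [Finset.sum_mul]
    refine Finset.sum_congr rfl fun g _ => ?_
    rw [smul_mul', x.1.2 g]
  nm_add a b := by
    refine Prod.ext (Subtype.ext ?_) ?_
    · simp only [Prod.fst_add, Prod.fst_sum, Subring.coe_add, AddSubmonoidClass.coe_finsetSum]
      change ∏ g : Cp p, g • (a + b) = ∏ g : Cp p, g • a + ∏ g : Cp p, g • b +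
        ∑ ω : MixedOrbit p, ∑ h : Cp p,
          h • ((∏ g ∈ ω.rep, g • a) * ∏ g ∈ (ω.rep)ᶜ, g • b)
      simp only [smul_add]
      rw [prod_add_eq]
      congr 1
      refine Finset.sum_congr rfl fun ω _ => Finset.sum_congr rfl fun h _ => ?_
      simp only [smul_mul', Finset.smul_prod', mul_smul]
    · simp only [Prod.snd_add, Prod.snd_sum]
      change Ideal.Quotient.mk _ (R.nm (a + b)) = Ideal.Quotient.mk _ (R.nm a) +
        Ideal.Quotient.mk _ (R.nm b) + ∑ ω : MixedOrbit p, 0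
      rw [R.nm_add, map_add, map_add, map_sum]
      congr 1
      exact Finset.sum_congr rfl fun ω _ =>
        Ideal.Quotient.eq_zero_iff_mem.2 (R.tr_mem_transferIdeal _)

/-- The coinduction `CoInd_e^{C_p} A` of a commutative ring `A` (a Tambara functor for the trivial
group): its levels are the functions on `C_p` with values in `A`, permuted by translation, and `A`;
the restriction is the diagonal, the transfer is the sum and the norm is the product of the
values. -/
def coind (p : ℕ) [Fact p.Prime] (A : Type u) [CommRing A] : CpTambara.{u} p where
  bot := Cp p → A
  top := A
  weyl := {
    smul := fun g f h => f (h * g)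
    one_smul := fun f => funext fun h => congrArg f (mul_one h)
    mul_smul := fun g g' f => funext fun h => congrArg f (mul_assoc h g g').symm
    smul_zero := fun _ => rfl
    smul_add := fun _ _ _ => rfl
    smul_one := fun _ => rfl
    smul_mul := fun _ _ _ => rfl }
  res := Pi.constRingHom (Cp p) A
  tr := {
    toFun := fun f => ∑ h, f h
    map_zero' := by simp
    map_add' := fun f f' => by simp [Finset.sum_add_distrib] }
  nm := {
    toFun := fun f => ∏ h, f h
    map_one' := by simp
    map_mul' := fun f f' => by simp [Finset.prod_mul_distrib] }
  smul_res _ _ := rfl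
  tr_smul g f := Equiv.sum_comp (Equiv.mulRight g) f
  nm_smul g f := Equiv.prod_comp (Equiv.mulRight g) f
  nm_zero := Finset.prod_eq_zero (Finset.mem_univ 1) rfl
  res_tr f := funext fun h => by
    rw [Finset.sum_apply]
    exact (Equiv.sum_comp (Equiv.mulLeft h) f).symm
  res_nm f := funext fun h => by
    rw [Finset.prod_apply]
    exact (Equiv.prod_comp (Equiv.mulLeft h) f).symm
  tr_mul_res f x := (Finset.sum_mul _ _ _).symm
  nm_add a b := by
    refine (prod_add_eq a b).trans ?_
    congr 1
    refine Finset.sum_congr rfl fun ω _ => Finset.sum_congr rfl fun h _ => ?_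
    simp only [Pi.mul_apply, Finset.prod_apply]
    rfl

/-- The canonical map `R → CoInd_e^{C_p} R(C_p/e)` (the unit of the adjunction between restriction
to the trivial group and coinduction): `a ↦ (g ↦ g • a)` on the level `C_p/e`, and the restriction
on the level `C_p/C_p`. -/
def coindUnit (R : CpTambara.{u} p) : Hom R (coind p R.bot) where
  bot := RingHom.pi fun g => MulSemiringAction.toRingHom (Cp p) R.bot g
  top := R.res
  map_smul g a := funext fun h => (mul_smul h g a).symm
  map_res x := funext fun h => R.smul_res h x
  map_tr a := R.res_tr a
  map_nm a := R.res_nm a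

/-- The canonical map `ghost(R) → CoInd_e^{C_p} R(C_p/e)`; note that
`ghost(R)(C_p/e) = R(C_p/e)`. -/
def ghostToCoind (R : CpTambara.{u} p) : Hom (ghost R) (coind p R.bot) := coindUnit (ghost R)

/-! ### Tambara functors presented by generators

Polynomial algebras and pushouts of Tambara functors are made of formal expressions in generators.
-/

/-- The two levels of a `C_p`-Tambara functor. -/
inductive Level : Type
  | bot : Level
  | top : Level

/-- The ring at a given level. -/
def level (S : CpTambara.{u} p) : Level → Type u
  | Level.bot => S.bot
  | Level.top => S.top

instance (S : CpTambara.{u} p) : (l : Level) → CommRing (S.level l)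
  | Level.bot => S.ringBot
  | Level.top => S.ringTop

instance (S : CpTambara.{u} p) : MulSemiringAction (Cp p) (S.level Level.bot) := S.weyl

/-- Formal expressions in generators `B` on the level `C_p/e` and `T` on the level `C_p/C_p`. -/
inductive Word (p : ℕ) (B T : Type u) : Level → Type u
  | genBot (b : B) : Word p B T Level.bot
  | genTop (t : T) : Word p B T Level.top
  | zero (l : Level) : Word p B T l
  | one (l : Level) : Word p B T l
  | add {l : Level} (v w : Word p B T l) : Word p B T l
  | mul {l : Level} (v w : Word p B T l) : Word p B T l
  | neg {l : Level} (w : Word p B T l) : Word p B T l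
  | smul (g : Cp p) (w : Word p B T Level.bot) : Word p B T Level.bot
  | res (w : Word p B T Level.top) : Word p B T Level.bot
  | tr (w : Word p B T Level.bot) : Word p B T Level.top
  | nm (w : Word p B T Level.bot) : Word p B T Level.top

/-- The value of an expression when the generators are interpreted in `S`. -/
def Word.eval {B T : Type u} (S : CpTambara.{u} p) (β : B → S.bot) (τ : T → S.top) :
    {l : Level} → Word p B T l → S.level l
  | _, Word.genBot b => β b
  | _, Word.genTop t => τ t
  | _, Word.zero _ => 0
  | _, Word.one _ => 1
  | _, Word.add v w => Word.eval S β τ v + Word.eval S β τ w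
  | _, Word.mul v w => Word.eval S β τ v * Word.eval S β τ w
  | _, Word.neg w => - Word.eval S β τ w
  | _, Word.smul g w => g • Word.eval S β τ w
  | _, Word.res w => S.res (Word.eval S β τ w)
  | _, Word.tr w => S.tr (Word.eval S β τ w)
  | _, Word.nm w => S.nm (Word.eval S β τ w)

/-- A class of interpretations of the generators `B` and `T` in Tambara functors. -/
abbrev Interp (p : ℕ) [Fact p.Prime] (B T : Type u) : Type (u + 1) :=
  (S : CpTambara.{u} p) → (B → S.bot) → (T → S.top) → Prop

section Presented

variable {B T : Type u} (K : Interp p B T)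

/-- Two expressions are identified when they have the same value under all interpretations in the
class `K`. -/
def wordSetoid (l : Level) : Setoid (Word p B T l) where
  r v w := ∀ (S : CpTambara.{u} p) (β : B → S.bot) (τ : T → S.top), K S β τ →
    v.eval S β τ = w.eval S β τ
  iseqv := ⟨fun _ _ _ _ _ => rfl, fun h S β τ k => (h S β τ k).symm,
    fun h h' S β τ k => (h S β τ k).trans (h' S β τ k)⟩

/-- One level of the presented Tambara functor. -/
def Presented (l : Level) : Type u := Quotient (wordSetoid K l)

namespace Presented

/-- The class of an expression. -/
def mk {l : Level} (w : Word p B T l) : Presented K l := Quotient.mk (wordSetoid K l) w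

variable {K}

/-- The value of an element of the presented Tambara functor under an interpretation. -/
def val {S : CpTambara.{u} p} {β : B → S.bot} {τ : T → S.top} (k : K S β τ) {l : Level} :
    Presented K l → S.level l :=
  Quotient.lift (fun w => w.eval S β τ) fun _ _ h => h S β τ k

theorem ext_val {l : Level} {x y : Presented K l}
    (h : ∀ (S : CpTambara.{u} p) (β : B → S.bot) (τ : T → S.top) (k : K S β τ),
      val k x = val k y) : x = y := by
  induction x using Quotient.ind
  induction y using Quotient.ind
  exact Quotient.sound fun S β τ k => h S β τ k

instance (l : Level) : Zero (Presented K l) := ⟨mk K (Word.zero l)⟩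
instance (l : Level) : One (Presented K l) := ⟨mk K (Word.one l)⟩
instance (l : Level) : Add (Presented K l) := ⟨Quotient.map₂ Word.add
  fun _ _ h _ _ h' S β τ k => congrArg₂ (· + ·) (h S β τ k) (h' S β τ k)⟩
instance (l : Level) : Mul (Presented K l) := ⟨Quotient.map₂ Word.mul
  fun _ _ h _ _ h' S β τ k => congrArg₂ (· * ·) (h S β τ k) (h' S β τ k)⟩
instance (l : Level) : Neg (Presented K l) := ⟨Quotient.map Word.neg
  fun _ _ h S β τ k => congrArg (- ·) (h S β τ k)⟩
instance : SMul (Cp p) (Presented K Level.bot) := ⟨fun g => Quotient.map (Word.smul g)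
  fun _ _ h S β τ k => congrArg (g • ·) (h S β τ k)⟩

/-- The restriction of the presented Tambara functor. -/
def resFun : Presented K Level.top → Presented K Level.bot := Quotient.map Word.res
  fun _ _ h S β τ k => congrArg S.res (h S β τ k)
/-- The transfer of the presented Tambara functor. -/
def trFun : Presented K Level.bot → Presented K Level.top := Quotient.map Word.tr
  fun _ _ h S β τ k => congrArg S.tr (h S β τ k)
/-- The norm of the presented Tambara functor. -/
def nmFun : Presented K Level.bot → Presented K Level.top := Quotient.map Word.nm
  fun _ _ h S β τ k => congrArg S.nm (h S β τ k)

section val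

variable {S : CpTambara.{u} p} {β : B → S.bot} {τ : T → S.top} (k : K S β τ)

theorem val_zero {l : Level} : val k (0 : Presented K l) = 0 := rfl
theorem val_one {l : Level} : val k (1 : Presented K l) = 1 := rfl
theorem val_add {l : Level} (x y : Presented K l) : val k (x + y) = val k x + val k y := by
  induction x using Quotient.ind
  induction y using Quotient.ind
  rfl
theorem val_mul {l : Level} (x y : Presented K l) : val k (x * y) = val k x * val k y := by
  induction x using Quotient.ind
  induction y using Quotient.ind
  rfl
theorem val_neg {l : Level} (x : Presented K l) : val k (-x) = -val k x := by
  induction x using Quotient.ind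
  rfl
theorem val_smul (g : Cp p) (x : Presented K Level.bot) :
    val k (g • x) = g • val k x := by
  induction x using Quotient.ind
  rfl
theorem val_res (x : Presented K Level.top) : val k (resFun x) = S.res (val k x) := by
  induction x using Quotient.ind
  rfl
theorem val_tr (x : Presented K Level.bot) : val k (trFun x) = S.tr (val k x) := by
  induction x using Quotient.ind
  rfl
theorem val_nm (x : Presented K Level.bot) : val k (nmFun x) = S.nm (val k x) := by
  induction x using Quotient.ind
  rfl

end val

instance (l : Level) : CommRing (Presented K l) where
  add_assoc x y z := ext_val fun S β τ k => by simp only [val_add, add_assoc]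
  zero_add x := ext_val fun S β τ k => by simp only [val_add, val_zero, zero_add]
  add_zero x := ext_val fun S β τ k => by simp only [val_add, val_zero, add_zero]
  add_comm x y := ext_val fun S β τ k => by simp only [val_add, add_comm]
  left_distrib x y z := ext_val fun S β τ k => by simp only [val_add, val_mul, mul_add]
  right_distrib x y z := ext_val fun S β τ k => by simp only [val_add, val_mul, add_mul]
  zero_mul x := ext_val fun S β τ k => by simp only [val_mul, val_zero, zero_mul]
  mul_zero x := ext_val fun S β τ k => by simp only [val_mul, val_zero, mul_zero]
  mul_assoc x y z := ext_val fun S β τ k => by simp only [val_mul, mul_assoc]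
  one_mul x := ext_val fun S β τ k => by simp only [val_mul, val_one, one_mul]
  mul_one x := ext_val fun S β τ k => by simp only [val_mul, val_one, mul_one]
  mul_comm x y := ext_val fun S β τ k => by simp only [val_mul, mul_comm]
  neg_add_cancel x := ext_val fun S β τ k => by
    simp only [val_add, val_neg, val_zero, neg_add_cancel]
  nsmul := nsmulRec
  zsmul := zsmulRec

/-- Evaluation as a ring homomorphism. -/
def valHom {S : CpTambara.{u} p} {β : B → S.bot} {τ : T → S.top} (k : K S β τ) (l : Level) :
    Presented K l →+* S.level l where
  toFun := val k
  map_zero' := val_zero k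
  map_one' := val_one k
  map_add' := val_add k
  map_mul' := val_mul k

theorem val_sum {S : CpTambara.{u} p} {β : B → S.bot} {τ : T → S.top} (k : K S β τ) {l : Level}
    {ι : Type*} (s : Finset ι) (f : ι → Presented K l) :
    val k (∑ i ∈ s, f i) = ∑ i ∈ s, val k (f i) := map_sum (valHom k l) f s

theorem val_prod {S : CpTambara.{u} p} {β : B → S.bot} {τ : T → S.top} (k : K S β τ) {l : Level}
    {ι : Type*} (s : Finset ι) (f : ι → Presented K l) :
    val k (∏ i ∈ s, f i) = ∏ i ∈ s, val k (f i) := map_prod (valHom k l) f s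

end Presented

open Presented in
/-- The Tambara functor presented by generators `B` and `T` that is universal for the class of
interpretations `K`: its elements are the formal expressions in the generators modulo the equations
that hold under all interpretations in the class. -/
def presented : CpTambara.{u} p where
  bot := Presented K Level.bot
  top := Presented K Level.top
  weyl := {
    one_smul := fun x => ext_val fun S β τ k => by
      rw [val_smul]; exact one_smul _ _
    mul_smul := fun g h x => ext_val fun S β τ k => by
      simp only [val_smul]; exact mul_smul g h _
    smul_zero := fun g => ext_val fun S β τ k => by
      rw [val_smul]; exact smul_zero g
    smul_add := fun g x y => ext_val fun S β τ k => by
      simp only [val_smul, val_add]; exact smul_add g _ _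
    smul_one := fun g => ext_val fun S β τ k => by
      rw [val_smul]; exact smul_one g
    smul_mul := fun g x y => ext_val fun S β τ k => by
      simp only [val_smul, val_mul]; exact smul_mul' g _ _ }
  res := {
    toFun := resFun
    map_zero' := ext_val fun S β τ k => by rw [val_res]; exact map_zero S.res
    map_one' := ext_val fun S β τ k => by rw [val_res]; exact map_one S.res
    map_add' := fun x y => ext_val fun S β τ k => by
      simp only [val_res, val_add]; exact map_add S.res _ _
    map_mul' := fun x y => ext_val fun S β τ k => by
      simp only [val_res, val_mul]; exact map_mul S.res _ _ }
  tr := {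
    toFun := trFun
    map_zero' := ext_val fun S β τ k => by rw [val_tr]; exact map_zero S.tr
    map_add' := fun x y => ext_val fun S β τ k => by
      simp only [val_tr, val_add]; exact map_add S.tr _ _ }
  nm := {
    toFun := nmFun
    map_one' := ext_val fun S β τ k => by rw [val_nm]; exact map_one S.nm
    map_mul' := fun x y => ext_val fun S β τ k => by
      simp only [val_nm, val_mul]; exact map_mul S.nm _ _ }
  smul_res g x := ext_val fun S β τ k => by
    rw [val_smul]
    change g • val k (resFun x) = val k (resFun x)
    rw [val_res]
    exact S.smul_res g _
  tr_smul g a := ext_val fun S β τ k => by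
    change val k (trFun (g • a)) = val k (trFun a)
    rw [val_tr, val_tr, val_smul]
    exact S.tr_smul g _
  nm_smul g a := ext_val fun S β τ k => by
    change val k (nmFun (g • a)) = val k (nmFun a)
    rw [val_nm, val_nm, val_smul]
    exact S.nm_smul g _
  nm_zero := ext_val fun S β τ k => by
    change val k (nmFun 0) = _
    rw [val_nm]
    exact S.nm_zero
  res_tr a := ext_val fun S β τ k => by
    change val k (resFun (trFun a)) = _
    rw [val_res, val_tr, val_sum]
    simp only [val_smul]
    exact S.res_tr _
  res_nm a := ext_val fun S β τ k => by
    change val k (resFun (nmFun a)) = _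
    rw [val_res, val_nm, val_prod]
    simp only [val_smul]
    exact S.res_nm _
  tr_mul_res a x := ext_val fun S β τ k => by
    change val k (trFun (a * resFun x)) = val k (trFun a * x)
    rw [val_tr, val_mul, val_mul, val_tr, val_res]
    exact S.tr_mul_res _ _
  nm_add a b := ext_val fun S β τ k => by
    change val k (nmFun (a + b)) = val k (nmFun a + nmFun b + ∑ ω : MixedOrbit p,
      trFun ((∏ g ∈ ω.rep, g • a) * ∏ g ∈ (ω.rep)ᶜ, g • b))
    simp only [val_nm, val_add, val_sum, val_tr, val_mul, val_prod, val_smul]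
    exact S.nm_add _ _

/-- An interpretation in the class extends to a morphism. -/
def presentedLift {K : Interp p B T} {S : CpTambara.{u} p} {β : B → S.bot} {τ : T → S.top}
    (k : K S β τ) : Hom (presented K) S where
  bot := Presented.valHom k Level.bot
  top := Presented.valHom k Level.top
  map_smul := Presented.val_smul k
  map_res := Presented.val_res k
  map_tr := Presented.val_tr k
  map_nm := Presented.val_nm k

/-- If all interpretations in the class restrict to morphisms out of `R`, along maps from `R` to
the generators, then so do the classes of the generators. -/
def presentedOf {K : Interp p B T} {R : CpTambara.{u} p} (i : R.bot → B) (j : R.top → T)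
    (h : ∀ (S : CpTambara.{u} p) (β : B → S.bot) (τ : T → S.top), K S β τ →
      ∃ φ : Hom R S, (∀ a, β (i a) = φ.bot a) ∧ ∀ x, τ (j x) = φ.top x) :
    Hom R (presented K) where
  bot := {
    toFun := fun a => Presented.mk K (Word.genBot (i a))
    map_zero' := Quotient.sound fun S β τ k => by
      obtain ⟨φ, h1, h2⟩ := h S β τ k
      exact (h1 _).trans (map_zero φ.bot)
    map_one' := Quotient.sound fun S β τ k => by
      obtain ⟨φ, h1, h2⟩ := h S β τ k
      exact (h1 _).trans (map_one φ.bot)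
    map_add' := fun a b => Quotient.sound fun S β τ k => by
      obtain ⟨φ, h1, h2⟩ := h S β τ k
      change β (i (a + b)) = β (i a) + β (i b)
      rw [h1, h1, h1, map_add]
    map_mul' := fun a b => Quotient.sound fun S β τ k => by
      obtain ⟨φ, h1, h2⟩ := h S β τ k
      change β (i (a * b)) = β (i a) * β (i b)
      rw [h1, h1, h1, map_mul] }
  top := {
    toFun := fun x => Presented.mk K (Word.genTop (j x))
    map_zero' := Quotient.sound fun S β τ k => by
      obtain ⟨φ, h1, h2⟩ := h S β τ k
      exact (h2 _).trans (map_zero φ.top)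
    map_one' := Quotient.sound fun S β τ k => by
      obtain ⟨φ, h1, h2⟩ := h S β τ k
      exact (h2 _).trans (map_one φ.top)
    map_add' := fun a b => Quotient.sound fun S β τ k => by
      obtain ⟨φ, h1, h2⟩ := h S β τ k
      change τ (j (a + b)) = τ (j a) + τ (j b)
      rw [h2, h2, h2, map_add]
    map_mul' := fun a b => Quotient.sound fun S β τ k => by
      obtain ⟨φ, h1, h2⟩ := h S β τ k
      change τ (j (a * b)) = τ (j a) * τ (j b)
      rw [h2, h2, h2, map_mul] }
  map_smul g a := Quotient.sound fun S β τ k => by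
    obtain ⟨φ, h1, h2⟩ := h S β τ k
    change β (i (g • a)) = g • β (i a)
    rw [h1, h1, φ.map_smul]
  map_res x := Quotient.sound fun S β τ k => by
    obtain ⟨φ, h1, h2⟩ := h S β τ k
    change β (i (R.res x)) = S.res (τ (j x))
    rw [h1, h2, φ.map_res]
  map_tr a := Quotient.sound fun S β τ k => by
    obtain ⟨φ, h1, h2⟩ := h S β τ k
    change τ (j (R.tr a)) = S.tr (β (i a))
    rw [h1, h2, φ.map_tr]
  map_nm a := Quotient.sound fun S β τ k => by
    obtain ⟨φ, h1, h2⟩ := h S β τ k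
    change τ (j (R.nm a)) = S.nm (β (i a))
    rw [h1, h2, φ.map_nm]

end Presented

/-! ### Morphisms of finite presentation -/

/-- The polynomial algebra over `R` on `m` generators on the level `C_p/e` and `n` generators on
the level `C_p/C_p`: it is universal among the Tambara functors with a morphism from `R` and with
chosen elements `m` on the level `C_p/e` and `n` on the level `C_p/C_p`. -/
def poly (R : CpTambara.{u} p) (m n : ℕ) : CpTambara.{u} p :=
  presented (B := R.bot ⊕ Fin m) (T := R.top ⊕ Fin n) fun S β τ =>
    ∃ φ : Hom R S, (∀ a, β (Sum.inl a) = φ.bot a) ∧ ∀ x, τ (Sum.inl x) = φ.top x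

/-- The structure morphism of the polynomial algebra. -/
def polyC (R : CpTambara.{u} p) (m n : ℕ) : Hom R (poly R m n) :=
  presentedOf Sum.inl Sum.inl fun _ _ _ k => k

/-- `S` is isomorphic, as an algebra over `R`, to the quotient of a polynomial algebra on finitely
many generators by a finitely generated Tambara ideal. -/
def Hom.FinitelyPresented {R S : CpTambara.{u} p} (f : Hom R S) : Prop :=
  ∃ (m n : ℕ) (π : Hom (poly R m n) S), π.comp (polyC R m n) = f ∧
    Function.Surjective π.bot ∧ Function.Surjective π.top ∧ π.ker.FG

/-! ### Modules, box products and flatness -/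

/-- A module over (the Green functor underlying) the Tambara functor `R`: a Mackey functor with
levels `bot = M(C_p/e)` and `top = M(C_p/C_p)` and an action of `R`. -/
structure Mod (R : CpTambara.{u} p) : Type (u + 1) where
  bot : Type u
  top : Type u
  [groupBot : AddCommGroup bot]
  [groupTop : AddCommGroup top]
  [moduleBot : Module R.bot bot]
  [moduleTop : Module R.top top]
  [weyl : DistribMulAction (Cp p) bot]
  res : top →+ bot
  tr : bot →+ top
  weyl_smul : ∀ (g : Cp p) (a : R.bot) (m : bot), g • (a • m) = (g • a) • (g • m)
  weyl_res : ∀ (g : Cp p) (y : top), g • res y = res y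
  tr_weyl : ∀ (g : Cp p) (m : bot), tr (g • m) = tr m
  res_tr : ∀ m : bot, res (tr m) = ∑ g : Cp p, g • m
  res_smul : ∀ (x : R.top) (y : top), res (x • y) = R.res x • res y
  tr_res_smul : ∀ (x : R.top) (m : bot), tr (R.res x • m) = x • tr m
  tr_smul_res : ∀ (a : R.bot) (y : top), tr (a • res y) = R.tr a • y

attribute [instance] Mod.groupBot Mod.groupTop Mod.moduleBot Mod.moduleTop Mod.weyl

namespace Mod

variable {R : CpTambara.{u} p}

/-- A morphism of modules over `R`. -/
structure Hom (M N : Mod R) : Type u where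
  bot : M.bot →ₗ[R.bot] N.bot
  top : M.top →ₗ[R.top] N.top
  map_weyl : ∀ (g : Cp p) (m : M.bot), bot (g • m) = g • bot m
  map_res : ∀ y : M.top, bot (M.res y) = N.res (top y)
  map_tr : ∀ m : M.bot, top (M.tr m) = N.tr (bot m)

/-- The level `C_p/e` of the box product of `M` and `N` over `R`. -/
abbrev boxBot (M N : Mod R) : Type u := M.bot ⊗[R.bot] N.bot

/-- The relations on the level `C_p/C_p` of the box product, where the second summand stands for
the transfers: Frobenius reciprocity in both variables, and invariance of the transfer. -/
def boxRel (M N : Mod R) : AddSubgroup ((M.top ⊗[R.top] N.top) × (M.bot ⊗[R.bot] N.bot)) :=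
  AddSubgroup.closure
    ({z | ∃ (y : M.top) (n : N.bot), z = (y ⊗ₜ N.tr n, -(M.res y ⊗ₜ n))} ∪
     {z | ∃ (m : M.bot) (y : N.top), z = (M.tr m ⊗ₜ y, -(m ⊗ₜ N.res y))} ∪
     {z | ∃ (g : Cp p) (m : M.bot) (n : N.bot), z = (0, (g • m) ⊗ₜ (g • n) - m ⊗ₜ n)})

/-- The level `C_p/C_p` of the box product of `M` and `N` over `R`. -/
abbrev boxTop (M N : Mod R) : Type u :=
  ((M.top ⊗[R.top] N.top) × (M.bot ⊗[R.bot] N.bot)) ⧸ boxRel M N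

/-- The map induced on the level `C_p/e` of box products. -/
def boxMapBot {M M' : Mod R} (f : Hom M M') (N : Mod R) : boxBot M N →+ boxBot M' N :=
  (f.bot.rTensor N.bot).toAddMonoidHom

/-- The map induced on the level `C_p/C_p` of box products. -/
def boxMapTop {M M' : Mod R} (f : Hom M M') (N : Mod R) : boxTop M N →+ boxTop M' N :=
  QuotientAddGroup.map (boxRel M N) (boxRel M' N)
    (AddMonoidHom.prodMap (f.top.rTensor N.top).toAddMonoidHom
      (f.bot.rTensor N.bot).toAddMonoidHom) (by
    rw [boxRel, AddSubgroup.closure_le]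
    rintro _ ((⟨y, n, rfl⟩ | ⟨m, y, rfl⟩) | ⟨g, m, n, rfl⟩)
    · refine AddSubgroup.subset_closure (Or.inl (Or.inl ⟨f.top y, n, ?_⟩))
      simp [f.map_res]
    · refine AddSubgroup.subset_closure (Or.inl (Or.inr ⟨f.bot m, y, ?_⟩))
      simp [f.map_tr]
    · refine AddSubgroup.subset_closure (Or.inr ⟨g, f.bot m, n, ?_⟩)
      simp [f.map_weyl])

/-- The module `N` is flat: the functor that takes the box product with `N` over `R` is exact. -/
def Flat (N : Mod R) : Prop :=
  ∀ (M M' M'' : Mod R) (f : Hom M M') (g : Hom M' M''),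
    Function.Exact f.bot g.bot → Function.Exact f.top g.top →
      Function.Exact (boxMapBot f N) (boxMapBot g N) ∧
        Function.Exact (boxMapTop f N) (boxMapTop g N)

end Mod

/-- The target of a morphism `f` as a module over its source. -/
def Hom.toMod {R S : CpTambara.{u} p} (f : Hom R S) : Mod R where
  bot := S.bot
  top := S.top
  moduleBot := Module.compHom S.bot f.bot
  moduleTop := Module.compHom S.top f.top
  res := S.res.toAddMonoidHom
  tr := S.tr
  weyl_smul g a m := by
    change g • (f.bot a * m) = f.bot (g • a) * g • m
    rw [smul_mul', f.map_smul]
  weyl_res := S.smul_res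
  tr_weyl := S.tr_smul
  res_tr := S.res_tr
  res_smul x y := by
    change S.res (f.top x * y) = f.bot (R.res x) * S.res y
    rw [map_mul, f.map_res]
  tr_res_smul x m := by
    change S.tr (f.bot (R.res x) * m) = f.top x * S.tr m
    rw [f.map_res, mul_comm, S.tr_mul_res, mul_comm]
  tr_smul_res a y := by
    change S.tr (f.bot a * S.res y) = f.top (R.tr a) * y
    rw [f.map_tr, S.tr_mul_res]

/-! ### Genuine Kähler differentials -/

/-- The box product `S □_R S` of the algebra `S` over `R` with itself, as a Tambara functor. It is
the coproduct of two copies of the algebra `S`: the Tambara functor that is universal for two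
morphisms from `S` which agree on `R`. -/
def boxSelf {R S : CpTambara.{u} p} (f : Hom R S) : CpTambara.{u} p :=
  presented (B := S.bot ⊕ S.bot) (T := S.top ⊕ S.top) fun Q β τ =>
    ∃ φ ψ : Hom S Q, φ.comp f = ψ.comp f ∧
      β = Sum.elim φ.bot ψ.bot ∧ τ = Sum.elim φ.top ψ.top

/-- The multiplication `S □_R S → S`. -/
def boxSelfMul {R S : CpTambara.{u} p} (f : Hom R S) : Hom (boxSelf f) S :=
  presentedLift (β := Sum.elim (Hom.id S).bot (Hom.id S).bot)
    (τ := Sum.elim (Hom.id S).top (Hom.id S).top) ⟨Hom.id S, Hom.id S, rfl, rfl, rfl⟩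

/-- The ideal `I^{>1}` generated by the products and the norms of elements of `I`. -/
def TIdeal.decomposables {R : CpTambara.{u} p} (I : TIdeal R) : TIdeal R :=
  TIdeal.span (Set.image2 (fun a b => a * b) (I.bot : Set R.bot) (I.bot : Set R.bot))
    (Set.image2 (fun x y => x * y) (I.top : Set R.top) (I.top : Set R.top) ∪
      R.nm '' (I.bot : Set R.bot))

/-- The level `C_p/e` of the genuine Kähler differentials `I/I^{>1}`, where `I` is the kernel of
the multiplication `S □_R S → S`. -/
abbrev kaehlerBot {R S : CpTambara.{u} p} (f : Hom R S) : Type u :=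
  (boxSelfMul f).ker.bot ⧸
    Submodule.comap (Submodule.subtype (boxSelfMul f).ker.bot)
       (boxSelfMul f).ker.decomposables.bot

/-- The level `C_p/C_p` of the genuine Kähler differentials `I/I^{>1}`. -/
abbrev kaehlerTop {R S : CpTambara.{u} p} (f : Hom R S) : Type u :=
  (boxSelfMul f).ker.top ⧸
    Submodule.comap (Submodule.subtype (boxSelfMul f).ker.top)
       (boxSelfMul f).ker.decomposables.top

/-- An étale morphism: finitely presented, flat, with vanishing genuine Kähler differentials. -/
structure Hom.Etale {R S : CpTambara.{u} p} (f : Hom R S) : Prop where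
  finitelyPresented : f.FinitelyPresented
  flat : f.toMod.Flat
  kaehlerBot : Subsingleton (kaehlerBot f)
  kaehlerTop : Subsingleton (kaehlerTop f)

end CpTambara

/-!
The coinduction of `G(C_p/e)` is the universal `G`-algebra with a free idempotent: an element `e`
of the level `C_p/e` with `e * g • e = 0` for `g ≠ 1` and `Tr e = 1`, namely the indicator function
of the neutral element. These finitely many relations make the unit `G → CoInd G(C_p/e)` finitely
presented. It is unramified because a difference of two idempotents is its own cube, so that the
two images of the indicator function in `CoInd □_G CoInd` agree modulo decomposables. It is flat
because `CoInd G(C_p/e)` is free on the level `C_p/e`, while its transfer is surjective and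
identifies the level `C_p/C_p` of `M □_G CoInd G(C_p/e)` with `M(C_p/e)`. The canonical map is the
case `G = ghost R`.

If `Tr` is not surjective, take a maximal ideal `q` of `R(C_p/C_p)/im(Tr)`. The norm induces a ring
homomorphism from `R(C_p/e)` to this quotient, and the preimage of `q` along it gives a prime `Q` of
the coinduction. The prime of the ghost given by `q` lies below the image of `Q`, but does not
contain the element `(0, 1)` of the kernel of the canonical map. Hence the image of the map of
spectra is not stable under generization, and so it is not open.
-/

namespace CpTambara

variable {p : ℕ} [Fact p.Prime]

/-! ### Quotients by Tambara ideals -/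

namespace Hom

variable {R S : CpTambara.{u} p} {f g : Hom R S}

theorem congr_bot (h : f = g) (a : R.bot) : f.bot a = g.bot a := by rw [h]

theorem congr_top (h : f = g) (x : R.top) : f.top x = g.top x := by rw [h]

theorem ker_le_ker_comp (f : Hom R S) {T : CpTambara.{u} p} (g : Hom S T) :
    f.ker ≤ (g.comp f).ker :=
  ⟨fun _ ha => (congrArg g.bot ha).trans (map_zero g.bot),
    fun _ hx => (congrArg g.top hx).trans (map_zero g.top)⟩

end Hom

namespace TIdeal

variable {R S : CpTambara.{u} p}

instance : PartialOrder (TIdeal R) where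
  le_refl _ := ⟨le_rfl, le_rfl⟩
  le_trans _ _ _ h h' := ⟨h.1.trans h'.1, h.2.trans h'.2⟩
  le_antisymm _ _ h h' := TIdeal.ext (h.1.antisymm h'.1) (h.2.antisymm h'.2)

theorem subset_span_bot {s : Set R.bot} {t : Set R.top} : s ⊆ (span s t).bot :=
  (span_le.1 (le_refl (span s t))).1

theorem subset_span_top {s : Set R.bot} {t : Set R.top} : t ⊆ (span s t).top :=
  (span_le.1 (le_refl (span s t))).2

theorem fg_span {s : Set R.bot} {t : Set R.top} (hs : s.Finite) (ht : t.Finite) :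
    (span s t).FG :=
  ⟨hs.toFinset, ht.toFinset, by rw [hs.coe_toFinset, ht.coe_toFinset]⟩

theorem nm_sub_nm_mem (I : TIdeal R) {a b : R.bot} (h : a - b ∈ I.bot) :
    R.nm a - R.nm b ∈ I.top := by
  have nm_eq : R.nm a - R.nm b = R.nm (a - b) + ∑ ω : MixedOrbit p,
      R.tr ((∏ g ∈ ω.rep, g • (a - b)) * ∏ g ∈ (ω.rep)ᶜ, g • b) := by
    rw [sub_eq_iff_eq_add, add_right_comm, ← R.nm_add, sub_add_cancel]
  rw [nm_eq]
  refine I.top.add_mem (I.nm_mem h) (Ideal.sum_mem _ fun ω _ => I.tr_mem ?_)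
  obtain ⟨g, hg⟩ := (Quotient.out ω : MixedSubset p).2.1
  exact Ideal.mul_mem_right _ _ (Ideal.prod_mem _ hg (I.smul_mem g h))

/-- The action of `C_p` on the level `C_p/e` of the quotient by `I`. -/
abbrev quotientAction (I : TIdeal R) : MulSemiringAction (Cp p) (R.bot ⧸ I.bot) where
  smul g := Ideal.quotientMap I.bot (MulSemiringAction.toRingHom (Cp p) R.bot g)
    fun _ h => I.smul_mem g h
  one_smul := Ideal.Quotient.mk_surjective.forall.2 fun a =>
    congrArg (Ideal.Quotient.mk I.bot) (one_smul (Cp p) a)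
  mul_smul g h := Ideal.Quotient.mk_surjective.forall.2 fun a =>
    congrArg (Ideal.Quotient.mk I.bot) (mul_smul g h a)
  smul_zero _ := map_zero (Ideal.quotientMap ..)
  smul_add _ := map_add (Ideal.quotientMap ..)
  smul_one _ := map_one (Ideal.quotientMap ..)
  smul_mul _ := map_mul (Ideal.quotientMap ..)

/-- The transfer of the quotient by `I`. -/
def quotientTr (I : TIdeal R) : R.bot ⧸ I.bot →+ R.top ⧸ I.top :=
  QuotientAddGroup.map I.bot.toAddSubgroup I.top.toAddSubgroup R.tr fun _ h => I.tr_mem h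

/-- The norm of the quotient by `I`. -/
def quotientNm (I : TIdeal R) : R.bot ⧸ I.bot →* R.top ⧸ I.top where
  toFun := Quotient.lift (fun a => Ideal.Quotient.mk I.top (R.nm a)) fun _ _ h =>
    Ideal.Quotient.eq.2 (I.nm_sub_nm_mem ((Submodule.quotientRel_def _).1 h))
  map_one' := congrArg (Ideal.Quotient.mk I.top) R.nm.map_one
  map_mul' := Ideal.Quotient.mk_surjective.forall₂.2 fun a b =>
    congrArg (Ideal.Quotient.mk I.top) (R.nm.map_mul a b)

/-- The quotient of a Tambara functor by a Tambara ideal. -/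
def quotient (I : TIdeal R) : CpTambara.{u} p where
  bot := R.bot ⧸ I.bot
  top := R.top ⧸ I.top
  weyl := I.quotientAction
  res := Ideal.quotientMap I.bot R.res fun _ h => I.res_mem h
  tr := I.quotientTr
  nm := I.quotientNm
  smul_res g := Ideal.Quotient.mk_surjective.forall.2 fun x =>
    congrArg (Ideal.Quotient.mk I.bot) (R.smul_res g x)
  tr_smul g := Ideal.Quotient.mk_surjective.forall.2 fun a =>
    congrArg (Ideal.Quotient.mk I.top) (R.tr_smul g a)
  nm_smul g := Ideal.Quotient.mk_surjective.forall.2 fun a =>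
    congrArg (Ideal.Quotient.mk I.top) (R.nm_smul g a)
  nm_zero := congrArg (Ideal.Quotient.mk I.top) R.nm_zero
  res_tr := Ideal.Quotient.mk_surjective.forall.2 fun a =>
    (congrArg (Ideal.Quotient.mk I.bot) (R.res_tr a)).trans (map_sum _ _ _)
  res_nm := Ideal.Quotient.mk_surjective.forall.2 fun a =>
    (congrArg (Ideal.Quotient.mk I.bot) (R.res_nm a)).trans (map_prod _ _ _)
  tr_mul_res := Ideal.Quotient.mk_surjective.forall.2 fun a =>
    Ideal.Quotient.mk_surjective.forall.2 fun x =>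
      congrArg (Ideal.Quotient.mk I.top) (R.tr_mul_res a x)
  nm_add := Ideal.Quotient.mk_surjective.forall₂.2 fun a b => by
    refine (congrArg (Ideal.Quotient.mk I.top) (R.nm_add a b)).trans ?_
    rw [map_add, map_add, map_sum]
    refine congrArg _ (Finset.sum_congr rfl fun ω _ => ?_)
    change I.quotientTr (Ideal.Quotient.mk I.bot _) = _
    rw [map_mul, map_prod, map_prod]
    rfl

/-- The projection onto the quotient by a Tambara ideal. -/
def quotientMk (I : TIdeal R) : Hom R I.quotient where
  bot := Ideal.Quotient.mk I.bot
  top := Ideal.Quotient.mk I.top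
  map_smul _ _ := rfl
  map_res _ := rfl
  map_tr _ := rfl
  map_nm _ := rfl

theorem ker_quotientMk (I : TIdeal R) : I.quotientMk.ker = I :=
  TIdeal.ext Ideal.mk_ker Ideal.mk_ker

theorem ker_eq_of_comp_eq_quotientMk {I : TIdeal R} {f : Hom R S} {g : Hom S I.quotient}
    (hI : I ≤ f.ker) (h : g.comp f = I.quotientMk) : f.ker = I :=
  le_antisymm ((f.ker_le_ker_comp g).trans_eq (by rw [h, ker_quotientMk])) hI

end TIdeal

/-! ### Polynomial algebras -/

namespace Presented

variable {B T : Type u} {K : Interp p B T} {S : CpTambara.{u} p}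

/-- The component at a level of a morphism out of a presented Tambara functor. -/
def homAt (φ : Hom (presented K) S) : (l : Level) → Presented K l →+* S.level l
  | Level.bot => φ.bot
  | Level.top => φ.top

theorem homAt_mk (φ : Hom (presented K) S) {l : Level} (w : Word p B T l) :
    homAt φ l (mk K w) = w.eval S (fun b => φ.bot (mk K (Word.genBot b)))
      (fun t => φ.top (mk K (Word.genTop t))) := by
  induction w with
  | genBot b => rfl
  | genTop t => rfl
  | zero l => exact map_zero (homAt φ l)
  | one l => exact map_one (homAt φ l)
  | add v w hv hw => exact (map_add (homAt φ _) _ _).trans (congrArg₂ _ hv hw)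
  | mul v w hv hw => exact (map_mul (homAt φ _) _ _).trans (congrArg₂ _ hv hw)
  | neg w hw => exact (map_neg (homAt φ _) _).trans (congrArg _ hw)
  | smul g w hw => exact (φ.map_smul g _).trans (congrArg _ hw)
  | res w hw => exact (φ.map_res _).trans (congrArg _ hw)
  | tr w hw => exact (φ.map_tr _).trans (congrArg _ hw)
  | nm w hw => exact (φ.map_nm _).trans (congrArg _ hw)

theorem hom_ext {φ ψ : Hom (presented K) S}
    (hB : ∀ b, φ.bot (mk K (Word.genBot b)) = ψ.bot (mk K (Word.genBot b)))
    (hT : ∀ t, φ.top (mk K (Word.genTop t)) = ψ.top (mk K (Word.genTop t))) : φ = ψ := by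
  have homAt_eq (l : Level) (w : Word p B T l) : homAt φ l (mk K w) = homAt ψ l (mk K w) := by
    rw [homAt_mk, homAt_mk, funext hB, funext hT]
  exact Hom.ext (RingHom.ext <| Quotient.ind (homAt_eq Level.bot))
    (RingHom.ext <| Quotient.ind (homAt_eq Level.top))

end Presented

section Poly

variable {R S : CpTambara.{u} p} {m n : ℕ}

/-- The `i`-th generator on the level `C_p/e` of the polynomial algebra. -/
def polyXBot (R : CpTambara.{u} p) (m n : ℕ) (i : Fin m) : (poly R m n).bot :=
  Presented.mk _ (Word.genBot (Sum.inr i))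

/-- The `i`-th generator on the level `C_p/C_p` of the polynomial algebra. -/
def polyXTop (R : CpTambara.{u} p) (m n : ℕ) (i : Fin n) : (poly R m n).top :=
  Presented.mk _ (Word.genTop (Sum.inr i))

/-- The morphism out of the polynomial algebra that extends `f` and has prescribed values on the
generators. -/
def polyLift (f : Hom R S) (b : Fin m → S.bot) (t : Fin n → S.top) : Hom (poly R m n) S :=
  presentedLift (β := Sum.elim f.bot b) (τ := Sum.elim f.top t) ⟨f, fun _ => rfl, fun _ => rfl⟩

theorem polyLift_comp_polyC (f : Hom R S) (b : Fin m → S.bot) (t : Fin n → S.top) :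
    (polyLift f b t).comp (polyC R m n) = f := rfl

theorem poly_hom_ext {φ ψ : Hom (poly R m n) S}
    (hC : φ.comp (polyC R m n) = ψ.comp (polyC R m n))
    (hBot : ∀ i, φ.bot (polyXBot R m n i) = ψ.bot (polyXBot R m n i))
    (hTop : ∀ i, φ.top (polyXTop R m n i) = ψ.top (polyXTop R m n i)) : φ = ψ :=
  Presented.hom_ext (Sum.rec (Hom.congr_bot hC) hBot) (Sum.rec (Hom.congr_top hC) hTop)

end Poly

/-! ### Free idempotents -/

section Coind

variable {A : Type u} [CommRing A]

theorem coind_smul_apply (g h : Cp p) (F : (coind p A).bot) :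
    (g • F : (coind p A).bot) h = F (h * g) := rfl

/-- The functions on `C_p` supported at the neutral element, as elements of the level `C_p/e` of
the coinduction. -/
def coindSingle : A →+ (coind p A).bot := AddMonoidHom.single (fun _ : Cp p => A) 1

theorem coindSingle_apply (a : A) (h : Cp p) :
    (coindSingle a : (coind p A).bot) h = if h = 1 then a else 0 :=
  Pi.single_apply 1 a h

theorem tr_coindSingle (a : A) : (coind p A).tr (coindSingle a) = a :=
  (Finset.sum_congr rfl fun h _ => coindSingle_apply a h).trans (Fintype.sum_ite_eq' 1 fun _ => a)

theorem coindSingle_mul (a : A) (F : (coind p A).bot) :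
    coindSingle a * F = coindSingle (a * F 1) :=
  (Pi.single_mul_left (i := (1 : Cp p)) (f := F) a).symm

theorem eq_sum_smul_coindSingle (F : (coind p A).bot) :
    F = ∑ h : Cp p, h⁻¹ • coindSingle (F h) := by
  funext k
  have term (h : Cp p) : (h⁻¹ • coindSingle (F h) : (coind p A).bot) k =
      if k = h then F h else 0 := by
    rw [coind_smul_apply, coindSingle_apply]
    simp only [mul_inv_eq_one]
  refine Eq.trans ?_ (Finset.sum_apply (M := fun _ : Cp p => A) k _ _).symm
  exact ((Finset.sum_congr rfl fun h _ => term h).trans (Fintype.sum_ite_eq k F)).symm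

theorem coindUnit_mul_coindSingle_one {G : CpTambara.{u} p} (a : G.bot) :
    (coindUnit G).bot a * coindSingle 1 = coindSingle a := by
  rw [mul_comm, coindSingle_mul, one_mul]
  exact congrArg coindSingle (one_smul (Cp p) a)

theorem coind_hom_ext {S : CpTambara.{u} p} {φ ψ : Hom (coind p A) S}
    (h : ∀ a, φ.bot (coindSingle a) = ψ.bot (coindSingle a)) : φ = ψ := by
  refine Hom.ext (RingHom.ext fun F => ?_) (RingHom.ext fun (a : A) => ?_)
  · rw [eq_sum_smul_coindSingle F]
    simp only [map_sum, φ.map_smul, ψ.map_smul, h]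
  · rw [← tr_coindSingle a, φ.map_tr, ψ.map_tr, h]

theorem coindUnit_hom_ext {G S : CpTambara.{u} p} {φ ψ : Hom (coind p G.bot) S}
    (hG : φ.comp (coindUnit G) = ψ.comp (coindUnit G))
    (h1 : φ.bot (coindSingle 1) = ψ.bot (coindSingle 1)) : φ = ψ :=
  coind_hom_ext fun a => by
    rw [← coindUnit_mul_coindSingle_one, map_mul, map_mul, h1]
    exact congrArg (· * _) (Hom.congr_bot hG a)

theorem surjective_of_coindSingle_mem_range {S : CpTambara.{u} p} {φ : Hom S (coind p A)}
    (h : ∀ a, coindSingle a ∈ φ.bot.range) :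
    Function.Surjective φ.bot ∧ Function.Surjective φ.top := by
  choose b hb using h
  refine ⟨fun F => ⟨∑ k : Cp p, k⁻¹ • b (F k), ?_⟩, fun (a : A) => ⟨S.tr (b a), ?_⟩⟩
  · simp only [map_sum, φ.map_smul, hb, ← eq_sum_smul_coindSingle]
  · rw [φ.map_tr, hb, tr_coindSingle]

end Coind

theorem mul_mul_congr {N : Type*} [CommSemigroup N] {e a a' b b' : N} (ha : e * a = e * a')
    (hb : e * b = e * b') : e * (a * b) = e * (a' * b') := by
  rw [← mul_assoc, ha, mul_assoc, mul_left_comm, hb, mul_left_comm]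

theorem mul_prod_congr {N ι : Type*} [CommMonoid N] (s : Finset ι) {e : N} {a b : ι → N}
    (h : ∀ i, e * a i = e * b i) : e * ∏ i ∈ s, a i = e * ∏ i ∈ s, b i :=
  Finset.prod_hom_rel (r := fun x y => e * x = e * y) rfl fun i _ _ => mul_mul_congr (h i)

/-- A free idempotent: an element of the level `C_p/e` that is orthogonal to its nontrivial
translates and has transfer `1`. Then `∑ g • e = Res (Tr e) = 1`, so the translates of `e` are a
complete system of orthogonal idempotents. -/
structure IsFreeIdempotent (S : CpTambara.{u} p) (e : S.bot) : Prop where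
  mul_smul_eq_zero : ∀ g : Cp p, g ≠ 1 → e * g • e = 0
  tr_eq_one : S.tr e = 1

theorem isFreeIdempotent_coindSingle_one (A : Type u) [CommRing A] :
    IsFreeIdempotent (coind p A) (coindSingle 1) where
  mul_smul_eq_zero g hg := by
    rw [coindSingle_mul, coind_smul_apply, coindSingle_apply, one_mul, one_mul, if_neg hg,
      map_zero]
  tr_eq_one := tr_coindSingle 1

namespace IsFreeIdempotent

variable {S : CpTambara.{u} p} {e : S.bot} (he : IsFreeIdempotent S e)

include he

theorem map {T : CpTambara.{u} p} (f : Hom S T) : IsFreeIdempotent T (f.bot e) where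
  mul_smul_eq_zero g hg := by
    rw [← f.map_smul, ← map_mul, he.mul_smul_eq_zero g hg, map_zero]
  tr_eq_one := by rw [← f.map_tr, he.tr_eq_one, map_one]

theorem sum_smul : ∑ g : Cp p, g • e = 1 := by
  rw [← S.res_tr, he.tr_eq_one, map_one]

theorem mul_self : e * e = e :=
  calc e * e = e * (1 : Cp p) • e := by rw [one_smul]
    _ = ∑ g : Cp p, e * g • e :=
      (Fintype.sum_eq_single 1 he.mul_smul_eq_zero).symm
    _ = e := by rw [← Finset.mul_sum, he.sum_smul, mul_one]

theorem mul_smul_sum (a : Cp p → S.bot) (g : Cp p) :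
    e * g • ∑ h : Cp p, h⁻¹ • (e * a h) = e * a g := by
  simp only [Finset.smul_sum, Finset.mul_sum, smul_smul, smul_mul', ← mul_assoc]
  rw [Fintype.sum_eq_single g, mul_inv_cancel, one_smul, one_smul, he.mul_self]
  intro h hh
  rw [he.mul_smul_eq_zero _ (mul_inv_eq_one.not.2 hh.symm), zero_mul]

theorem mul_res_tr (a : S.bot) : e * S.res (S.tr (e * a)) = e * a := by
  rw [S.res_tr, ← Equiv.sum_comp (Equiv.inv (Cp p)), ← one_smul (Cp p) (Finset.sum ..)]
  exact he.mul_smul_sum (fun _ => a) 1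

theorem ext_bot {x y : S.bot} (h : ∀ g : Cp p, e * g • x = e * g • y) : x = y := by
  have sum_inv_smul : ∑ g : Cp p, g⁻¹ • e = 1 :=
    (Equiv.sum_comp (Equiv.inv (Cp p)) (· • e)).trans he.sum_smul
  have sum_smul_mul (z : S.bot) : ∑ g : Cp p, g⁻¹ • (e * g • z) = z := by
    simp only [smul_mul', inv_smul_smul, ← Finset.sum_mul, sum_inv_smul, one_mul]
  rw [← sum_smul_mul x, ← sum_smul_mul y]
  simp only [h]

theorem ext_top {x y : S.top} (h : e * S.res x = e * S.res y) : x = y := by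
  have tr_mul_res (z : S.top) : S.tr (e * S.res z) = z := by
    rw [S.tr_mul_res, he.tr_eq_one, one_mul]
  rw [← tr_mul_res x, h, tr_mul_res]

section Lift

variable {A : Type u} [CommRing A] (φ : A →+* S.bot)

/-- The component on the level `C_p/e` of `coindLift`. -/
def coindLiftBot : (Cp p → A) →+* S.bot where
  toFun F := ∑ h : Cp p, h⁻¹ • (e * φ (F h))
  map_one' := he.ext_bot fun g => by
    rw [he.mul_smul_sum fun h => φ ((1 : Cp p → A) h), Pi.one_apply, map_one, smul_one]
  map_mul' F F' := he.ext_bot fun g => by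
    rw [smul_mul', he.mul_smul_sum fun h => φ ((F * F') h), Pi.mul_apply, map_mul]
    exact mul_mul_congr (he.mul_smul_sum (fun h => φ (F h)) g).symm
      (he.mul_smul_sum (fun h => φ (F' h)) g).symm
  map_zero' := by simp only [Pi.zero_apply, map_zero, mul_zero, smul_zero, Finset.sum_const_zero]
  map_add' F F' := by simp only [Pi.add_apply, map_add, mul_add, smul_add, Finset.sum_add_distrib]

theorem mul_smul_coindLiftBot (F : Cp p → A) (g : Cp p) :
    e * g • he.coindLiftBot φ F = e * φ (F g) :=
  he.mul_smul_sum (fun h => φ (F h)) g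

/-- The component on the level `C_p/C_p` of `coindLift`. -/
def coindLiftTop : A →+* S.top where
  toFun a := S.tr (e * φ a)
  map_one' := by rw [map_one, mul_one, he.tr_eq_one]
  map_mul' a b := he.ext_top <| by
    rw [he.mul_res_tr, map_mul φ, map_mul S.res]
    exact mul_mul_congr (he.mul_res_tr _).symm (he.mul_res_tr _).symm
  map_zero' := by rw [map_zero, mul_zero, map_zero]
  map_add' a b := by rw [map_add, mul_add, map_add]

theorem mul_res_coindLiftTop (a : A) : e * S.res (he.coindLiftTop φ a) = e * φ a :=
  he.mul_res_tr _

/-- The morphism out of the coinduction of `A` given by a ring homomorphism `φ` from `A` and the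
image `e` of `coindSingle 1`. -/
def coindLift : Hom (coind p A) S where
  bot := he.coindLiftBot φ
  top := he.coindLiftTop φ
  map_smul g := fun F : Cp p → A => he.ext_bot fun k =>
    calc e * k • he.coindLiftBot φ (fun h => F (h * g))
        = e * φ (F (k * g)) := he.mul_smul_coindLiftBot φ _ k
      _ = e * k • g • he.coindLiftBot φ F := by rw [smul_smul, mul_smul_coindLiftBot]
  map_res a := he.ext_bot fun k => by
    rw [S.smul_res]
    exact (he.mul_smul_coindLiftBot φ _ k).trans (he.mul_res_coindLiftTop φ a).symm
  map_tr := fun F : Cp p → A => he.ext_top <|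
    calc e * S.res (he.coindLiftTop φ (∑ h, F h))
        = ∑ h, e * φ (F h) := by rw [mul_res_coindLiftTop, map_sum, Finset.mul_sum]
      _ = e * S.res (S.tr (he.coindLiftBot φ F)) := by
        simp only [S.res_tr, Finset.mul_sum, mul_smul_coindLiftBot]
  map_nm := fun F : Cp p → A => he.ext_top <|
    calc e * S.res (he.coindLiftTop φ (∏ h, F h))
        = e * ∏ h, φ (F h) := by rw [mul_res_coindLiftTop, map_prod]
      _ = e * S.res (S.nm (he.coindLiftBot φ F)) := by
        rw [S.res_nm]
        exact mul_prod_congr _ fun g => (he.mul_smul_coindLiftBot φ F g).symm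

theorem coindLift_comp_coindUnit {G : CpTambara.{u} p} (f : Hom G S) :
    (he.coindLift f.bot).comp (coindUnit G) = f := by
  refine Hom.ext (RingHom.ext fun a => he.ext_bot fun g => ?_)
    (RingHom.ext fun x => he.ext_top ?_)
  · exact (he.mul_smul_coindLiftBot f.bot _ g).trans (congrArg (e * ·) (f.map_smul g a))
  · exact (he.mul_res_coindLiftTop f.bot _).trans (congrArg (e * ·) (f.map_res x))

theorem coindLift_coindSingle_one : (he.coindLift φ).bot (coindSingle 1) = e :=
  he.ext_bot fun g => by
    refine (he.mul_smul_coindLiftBot φ _ g).trans ?_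
    rw [coindSingle_apply]
    obtain rfl | hg := eq_or_ne g 1
    · rw [if_pos rfl, map_one, one_smul, mul_one, he.mul_self]
    · rw [if_neg hg, map_zero, mul_zero, he.mul_smul_eq_zero g hg]

end Lift

end IsFreeIdempotent

/-! ### Finite presentation -/

namespace TIdeal

variable {R S : CpTambara.{u} p}

/-- The smallest Tambara ideal modulo which `x` becomes a free idempotent. -/
def freeIdempotentIdeal (x : R.bot) : TIdeal R :=
  span ((fun g : Cp p => x * g • x) '' {1}ᶜ) {R.tr x - 1}

theorem fg_freeIdempotentIdeal (x : R.bot) : (freeIdempotentIdeal x).FG :=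
  fg_span (Set.toFinite _) (Set.finite_singleton _)

theorem freeIdempotentIdeal_le_ker_iff {f : Hom R S} {x : R.bot} :
    freeIdempotentIdeal x ≤ f.ker ↔ IsFreeIdempotent S (f.bot x) := by
  have map_mul_smul (g : Cp p) : f.bot (x * g • x) = f.bot x * g • f.bot x := by
    rw [map_mul, f.map_smul]
  have map_tr_sub_one : f.top (R.tr x - 1) = S.tr (f.bot x) - 1 := by
    rw [map_sub, f.map_tr, map_one]
  rw [freeIdempotentIdeal, span_le, Set.image_subset_iff, Set.singleton_subset_iff]
  refine ⟨fun ⟨hmul, htr⟩ => ⟨fun g hg => ?_, ?_⟩, fun h => ⟨fun g hg => ?_, ?_⟩⟩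
  · exact (map_mul_smul g).symm.trans (hmul hg)
  · exact sub_eq_zero.1 (map_tr_sub_one.symm.trans htr)
  · exact (map_mul_smul g).trans (h.mul_smul_eq_zero g hg)
  · exact map_tr_sub_one.trans (sub_eq_zero.2 h.tr_eq_one)

end TIdeal

theorem coindUnit_finitelyPresented (G : CpTambara.{u} p) : (coindUnit G).FinitelyPresented := by
  let x : (poly G 1 0).bot := polyXBot G 1 0 0
  let I : TIdeal (poly G 1 0) := TIdeal.freeIdempotentIdeal x
  let π : Hom (poly G 1 0) (coind p G.bot) :=
    polyLift (coindUnit G) (fun _ => coindSingle 1) Fin.elim0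
  have surjective : Function.Surjective π.bot ∧ Function.Surjective π.top :=
    surjective_of_coindSingle_mem_range fun a =>
      ⟨(polyC G 1 0).bot a * x, (map_mul π.bot _ _).trans (coindUnit_mul_coindSingle_one a)⟩
  have le_ker : I ≤ π.ker :=
    TIdeal.freeIdempotentIdeal_le_ker_iff.2 (isFreeIdempotent_coindSingle_one G.bot)
  have hx : IsFreeIdempotent I.quotient (I.quotientMk.bot x) :=
    TIdeal.freeIdempotentIdeal_le_ker_iff.1 I.ker_quotientMk.ge
  let φ : Hom G I.quotient := I.quotientMk.comp (polyC G 1 0)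
  have ker_eq : π.ker = I := by
    refine TIdeal.ker_eq_of_comp_eq_quotientMk (g := hx.coindLift φ.bot) le_ker
      (poly_hom_ext ?_ ?_ fun i => i.elim0)
    · exact hx.coindLift_comp_coindUnit φ
    · exact Fin.forall_fin_one.2 (hx.coindLift_coindSingle_one φ.bot)
  exact ⟨1, 0, π, polyLift_comp_polyC _ _ _, surjective.1, surjective.2,
    ker_eq ▸ TIdeal.fg_freeIdempotentIdeal x⟩

/-! ### Kähler differentials -/

section Kaehler

variable {R S : CpTambara.{u} p} (f : Hom R S)

/-- The first coprojection `S → S □_R S`. -/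
def boxSelfInl : Hom S (boxSelf f) :=
  presentedOf Sum.inl Sum.inl <| by
    rintro Q _ _ ⟨φ, ψ, -, rfl, rfl⟩
    exact ⟨φ, fun _ => rfl, fun _ => rfl⟩

/-- The second coprojection `S → S □_R S`. -/
def boxSelfInr : Hom S (boxSelf f) :=
  presentedOf Sum.inr Sum.inr <| by
    rintro Q _ _ ⟨φ, ψ, -, rfl, rfl⟩
    exact ⟨ψ, fun _ => rfl, fun _ => rfl⟩

theorem boxSelfInl_comp : (boxSelfInl f).comp f = (boxSelfInr f).comp f := by
  refine Hom.ext (RingHom.ext fun a => Quotient.sound ?_) (RingHom.ext fun x => Quotient.sound ?_)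
  · rintro Q _ _ ⟨φ, ψ, h, rfl, rfl⟩
    exact Hom.congr_bot h a
  · rintro Q _ _ ⟨φ, ψ, h, rfl, rfl⟩
    exact Hom.congr_top h x

variable {f}

theorem ker_boxSelfMul_le {I : TIdeal (boxSelf f)}
    (h : I.quotientMk.comp (boxSelfInl f) = I.quotientMk.comp (boxSelfInr f)) :
    (boxSelfMul f).ker ≤ I := by
  have factor : (I.quotientMk.comp (boxSelfInl f)).comp (boxSelfMul f) = I.quotientMk :=
    Presented.hom_ext (Sum.rec (fun _ => rfl) (Hom.congr_bot h))
      (Sum.rec (fun _ => rfl) (Hom.congr_top h))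
  exact (Hom.ker_le_ker_comp _ _).trans_eq (by rw [factor, I.ker_quotientMk])

theorem subsingleton_kaehlerBot_of_ker_le
    (h : (boxSelfMul f).ker ≤ (boxSelfMul f).ker.decomposables) : Subsingleton (kaehlerBot f) :=
  Submodule.Quotient.subsingleton_iff.2 (Submodule.comap_subtype_eq_top.2 h.1)

theorem subsingleton_kaehlerTop_of_ker_le
    (h : (boxSelfMul f).ker ≤ (boxSelfMul f).ker.decomposables) : Subsingleton (kaehlerTop f) :=
  Submodule.Quotient.subsingleton_iff.2 (Submodule.comap_subtype_eq_top.2 h.2)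

theorem TIdeal.sub_mem_decomposables_bot (I : TIdeal R) {e e' : R.bot} (he : IsIdempotentElem e)
    (he' : IsIdempotentElem e') (h : e - e' ∈ I.bot) : e - e' ∈ I.decomposables.bot := by
  have cube : e - e' = (e - e') * ((e - e') * (e - e')) := by
    linear_combination (e + 1 - 3 * e') * he.symm - (e' + 1 - 3 * e) * he'.symm
  rw [cube]
  exact subset_span_bot ⟨_, h, _, I.bot.mul_mem_left _ h, rfl⟩

theorem ker_boxSelfMul_coindUnit_le (G : CpTambara.{u} p) :
    (boxSelfMul (coindUnit G)).ker ≤ (boxSelfMul (coindUnit G)).ker.decomposables := by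
  let f := coindUnit G
  let I := (boxSelfMul f).ker
  let e := (boxSelfInl f).bot (coindSingle 1)
  let e' := (boxSelfInr f).bot (coindSingle 1)
  have he : IsIdempotentElem e :=
    ((isFreeIdempotent_coindSingle_one G.bot).map (boxSelfInl f)).mul_self
  have he' : IsIdempotentElem e' :=
    ((isFreeIdempotent_coindSingle_one G.bot).map (boxSelfInr f)).mul_self
  have sub_mem : e - e' ∈ I.bot := (map_sub (boxSelfMul f).bot e e').trans (sub_self _)
  refine ker_boxSelfMul_le (coindUnit_hom_ext ?_ ?_)
  · exact congrArg (Hom.comp I.decomposables.quotientMk) (boxSelfInl_comp f)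
  · exact Ideal.Quotient.eq.2 (I.sub_mem_decomposables_bot he he' sub_mem)

end Kaehler

/-! ### Flatness -/

theorem tensorProduct_addMonoidHom_ext {k M N A : Type*} [CommSemiring k] [AddCommMonoid M]
    [AddCommMonoid N] [Module k M] [Module k N] [AddMonoid A] {φ ψ : M ⊗[k] N →+ A}
    (h : ∀ m n, φ (m ⊗ₜ n) = ψ (m ⊗ₜ n)) : φ = ψ :=
  AddMonoidHom.ext fun t => t.induction_on (by rw [map_zero, map_zero]) h
    fun s t hs ht => by rw [map_add, map_add, hs, ht]

namespace Mod

variable {R : CpTambara.{u} p} {M N : Mod R} {A : Type*} [AddCommGroup A]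

/-- The transfer of the box product. -/
def boxTr : boxBot M N →+ boxTop M N :=
  (QuotientAddGroup.mk' (boxRel M N)).comp (AddMonoidHom.inr _ _)

/-- The map onto the summand of the level `C_p/C_p` of the box product that is not generated by
transfers. -/
def boxOfTop : M.top ⊗[R.top] N.top →+ boxTop M N :=
  (QuotientAddGroup.mk' (boxRel M N)).comp (AddMonoidHom.inl _ _)

theorem boxTr_smul_tmul_smul (g : Cp p) (m : M.bot) (n : N.bot) :
    boxTr ((g • m) ⊗ₜ[R.bot] (g • n)) = boxTr (m ⊗ₜ[R.bot] n) :=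
  QuotientAddGroup.eq_iff_sub_mem.2 <| AddSubgroup.subset_closure <| Or.inr
    ⟨g, m, n, Prod.ext (sub_self _) rfl⟩

theorem boxOfTop_tmul_tr (y : M.top) (n : N.bot) :
    boxOfTop (y ⊗ₜ[R.top] N.tr n) = boxTr (M.res y ⊗ₜ[R.bot] n) :=
  QuotientAddGroup.eq_iff_sub_mem.2 <| AddSubgroup.subset_closure <| Or.inl <| Or.inl
    ⟨y, n, Prod.ext (sub_zero _) (zero_sub _)⟩

theorem boxMapTop_boxTr {M' : Mod R} (f : Hom M M') (m : M.bot) (n : N.bot) :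
    boxMapTop f N (boxTr (m ⊗ₜ[R.bot] n)) = boxTr (f.bot m ⊗ₜ[R.bot] n) :=
  congrArg (QuotientAddGroup.mk' (boxRel M' N)) (Prod.ext (map_zero (f.top.rTensor N.top)) rfl)

/-- The homomorphism out of the level `C_p/C_p` of the box product given by homomorphisms out of
the two summands that respect the relations. -/
def boxTopLift (φ : M.top ⊗[R.top] N.top →+ A) (ψ : M.bot ⊗[R.bot] N.bot →+ A)
    (tmul_tr : ∀ y n, φ (y ⊗ₜ N.tr n) = ψ (M.res y ⊗ₜ n))
    (tr_tmul : ∀ m y, φ (M.tr m ⊗ₜ y) = ψ (m ⊗ₜ N.res y))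
    (smul_tmul_smul : ∀ (g : Cp p) m n, ψ ((g • m) ⊗ₜ (g • n)) = ψ (m ⊗ₜ n)) :
    boxTop M N →+ A :=
  QuotientAddGroup.lift (boxRel M N) (φ.coprod ψ) <| (AddSubgroup.closure_le _).2 <| by
    rintro _ ((⟨y, n, rfl⟩ | ⟨m, y, rfl⟩) | ⟨g, m, n, rfl⟩)
    all_goals refine AddMonoidHom.mem_ker.2 ((AddMonoidHom.coprod_apply _ _ _).trans ?_)
    · rw [map_neg, tmul_tr, add_neg_cancel]
    · rw [map_neg, tr_tmul, add_neg_cancel]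
    · rw [map_zero, zero_add, map_sub, smul_tmul_smul, sub_self]

theorem boxTopLift_boxTr {φ : M.top ⊗[R.top] N.top →+ A} {ψ : M.bot ⊗[R.bot] N.bot →+ A}
    {tmul_tr tr_tmul smul_tmul_smul} (t : M.bot ⊗[R.bot] N.bot) :
    boxTopLift φ ψ tmul_tr tr_tmul smul_tmul_smul (boxTr t) = ψ t :=
  (AddMonoidHom.coprod_apply φ ψ (0, t)).trans (by rw [map_zero, zero_add])

theorem boxTop_hom_ext_of_surjective_tr (hN : Function.Surjective N.tr) {φ ψ : boxTop M N →+ A}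
    (h : ∀ m n, φ (boxTr (m ⊗ₜ n)) = ψ (boxTr (m ⊗ₜ n))) : φ = ψ := by
  have comp_boxTr : φ.comp boxTr = ψ.comp boxTr := tensorProduct_addMonoidHom_ext h
  have comp_boxOfTop : φ.comp boxOfTop = ψ.comp boxOfTop :=
    tensorProduct_addMonoidHom_ext fun y => hN.forall.2 fun n => by
      rw [AddMonoidHom.comp_apply, AddMonoidHom.comp_apply, boxOfTop_tmul_tr, h]
  refine QuotientAddGroup.addMonoidHom_ext _ ?_
  rw [← AddMonoidHom.coprod_unique (φ.comp _), ← AddMonoidHom.coprod_unique (ψ.comp _)]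
  exact congrArg₂ AddMonoidHom.coprod comp_boxOfTop comp_boxTr

end Mod

section Flat

variable {G : CpTambara.{u} p}

variable (G) in
/-- The identification of the level `C_p/e` of the coinduction, on which `a` acts at `h` as
multiplication by `h • a`, with the free module of functions. -/
def coindUntwist : (coindUnit G).toMod.bot ≃ₗ[G.bot] (Cp p → G.bot) where
  toFun F h := h⁻¹ • (F : Cp p → G.bot) h
  invFun F := fun h : Cp p => h • F h
  map_add' F F' := funext fun h => smul_add h⁻¹ (F h : G.bot) (F' h)
  map_smul' a F := funext fun h => (smul_mul' h⁻¹ (h • a) (F h : G.bot)).trans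
    (congrArg (· * _) (inv_smul_smul h a))
  left_inv F := funext fun h => smul_inv_smul h (F h : G.bot)
  right_inv F := funext fun h => inv_smul_smul h (F h)

theorem coindUnit_toMod_tr_surjective : Function.Surjective (coindUnit G).toMod.tr :=
  fun a => ⟨coindSingle (A := G.bot) a, tr_coindSingle (A := G.bot) a⟩

variable (M : Mod G)

/-- The pairing of a module with the level `C_p/C_p` of the coinduction. -/
def coindPairingTop : M.top ⊗[G.top] (coindUnit G).toMod.top →+ M.bot :=
  TensorProduct.liftAddHom ((smulAddHom G.bot M.bot).flip.comp M.res) fun x y (a : G.bot) => by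
    change a • M.res (x • y) = (G.res x * a) • M.res y
    rw [M.res_smul, smul_smul, mul_comm]

theorem coindPairingTop_tmul (y : M.top) (a : G.bot) :
    coindPairingTop M (y ⊗ₜ a) = a • M.res y := rfl

/-- The pairing of functions on `C_p` with the orbit of an element of a module. -/
def orbitPairing : M.bot →+ (Cp p → G.bot) →+ M.bot :=
  ∑ h : Cp p, ((smulAddHom G.bot M.bot).comp (Pi.evalAddMonoidHom (fun _ => G.bot) h)).flip.comp
    (DistribSMul.toAddMonoidHom M.bot h)

theorem orbitPairing_apply (m : M.bot) (F : Cp p → G.bot) :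
    orbitPairing M m F = ∑ h : Cp p, F h • h • m := by
  simp only [orbitPairing, AddMonoidHom.finsetSum_apply, AddMonoidHom.coe_comp]
  rfl

/-- The pairing of a module with the level `C_p/e` of the coinduction. -/
def coindPairingBot : M.bot ⊗[G.bot] (coindUnit G).toMod.bot →+ M.bot :=
  TensorProduct.liftAddHom (orbitPairing M) fun a m (F : Cp p → G.bot) => by
    change orbitPairing M (a • m) F = orbitPairing M m fun h => h • a * F h
    rw [orbitPairing_apply, orbitPairing_apply]
    simp only [M.weyl_smul, smul_smul, mul_comm]

theorem coindPairingBot_tmul (m : M.bot) (F : Cp p → G.bot) :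
    coindPairingBot M (m ⊗ₜ F) = ∑ h : Cp p, F h • h • m :=
  orbitPairing_apply M m F

/-- The pairing of a module with the coinduction on the level `C_p/C_p` of their box product. -/
def coindPairing : Mod.boxTop M (coindUnit G).toMod →+ M.bot :=
  Mod.boxTopLift (coindPairingTop M) (coindPairingBot M)
    (fun y (F : Cp p → G.bot) => by
      refine (coindPairingTop_tmul M y (∑ h, F h)).trans ?_
      rw [coindPairingBot_tmul]
      simp only [M.weyl_res, Finset.sum_smul])
    (fun m (a : G.bot) => by
      refine Eq.trans ?_ (coindPairingBot_tmul M m fun _ => a).symm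
      rw [coindPairingTop_tmul, M.res_tr, Finset.smul_sum])
    fun g m (F : Cp p → G.bot) => by
      refine (coindPairingBot_tmul M _ fun h => F (h * g)).trans ?_
      rw [coindPairingBot_tmul, ← Equiv.sum_comp (Equiv.mulRight g) fun h => F h • h • m]
      simp only [smul_smul, Equiv.coe_mulRight]

theorem coindPairing_boxTr (m : M.bot) (F : Cp p → G.bot) :
    coindPairing M (Mod.boxTr (m ⊗ₜ F)) = ∑ h : Cp p, F h • h • m :=
  (Mod.boxTopLift_boxTr _).trans (coindPairingBot_tmul M m F)

variable (G) in
/-- The generator of the coinduction as a module. -/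
def coindGen : (coindUnit G).toMod.bot := coindSingle (A := G.bot) 1

theorem eq_sum_smul_coindGen (F : (coindUnit G).toMod.bot) :
    F = ∑ h : Cp p, h⁻¹ • (F : Cp p → G.bot) h • coindGen G :=
  (eq_sum_smul_coindSingle F).trans <| Finset.sum_congr rfl fun h _ =>
    congrArg (h⁻¹ • ·) (coindUnit_mul_coindSingle_one _).symm

theorem coindPairing_boxTr_coindGen (m : M.bot) :
    coindPairing M (Mod.boxTr (m ⊗ₜ coindGen G)) = m :=
  calc coindPairing M (Mod.boxTr (m ⊗ₜ coindGen G))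
      = ∑ h : Cp p, (if h = 1 then (1 : G.bot) else 0) • h • m :=
        (coindPairing_boxTr M m _).trans <| Finset.sum_congr rfl fun h _ =>
          congrArg (fun a : G.bot => a • h • m) (coindSingle_apply 1 h)
    _ = m := by simp only [ite_smul, one_smul, zero_smul, Fintype.sum_ite_eq']

theorem boxTr_tmul_eq_boxTr_tmul_coindGen (m : M.bot) (F : (coindUnit G).toMod.bot) :
    Mod.boxTr (m ⊗ₜ[G.bot] F) =
      Mod.boxTr ((∑ h : Cp p, (F : Cp p → G.bot) h • h • m) ⊗ₜ[G.bot] coindGen G) := by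
  have term (a : G.bot) (h : Cp p) : Mod.boxTr (m ⊗ₜ[G.bot] (h⁻¹ • a • coindGen G)) =
      Mod.boxTr ((a • h • m) ⊗ₜ[G.bot] coindGen G) := by
    rw [TensorProduct.smul_tmul, ← Mod.boxTr_smul_tmul_smul h⁻¹ (h • m), inv_smul_smul]
  rw [TensorProduct.sum_tmul, map_sum]
  refine (congrArg (fun F => Mod.boxTr (m ⊗ₜ[G.bot] F)) (eq_sum_smul_coindGen F)).trans ?_
  rw [TensorProduct.tmul_sum, map_sum]
  exact Finset.sum_congr rfl fun h _ => term _ h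

/-- The identification of the level `C_p/C_p` of the box product of `M` with the coinduction with
the level `C_p/e` of `M`. -/
def boxTopCoindEquiv : M.bot ≃+ Mod.boxTop M (coindUnit G).toMod :=
  AddMonoidHom.toAddEquiv
    (Mod.boxTr.comp ((TensorProduct.mk G.bot M.bot _).flip (coindGen G)).toAddMonoidHom)
    (coindPairing M)
    (AddMonoidHom.ext (coindPairing_boxTr_coindGen M))
    (Mod.boxTop_hom_ext_of_surjective_tr coindUnit_toMod_tr_surjective fun m F =>
      (congrArg (fun m' => Mod.boxTr (m' ⊗ₜ[G.bot] coindGen G)) (coindPairing_boxTr M m F)).trans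
        (boxTr_tmul_eq_boxTr_tmul_coindGen M m F).symm)

variable (G) in
theorem coindUnit_flat : (coindUnit G).toMod.Flat := by
  intro M M' M'' f g exact_bot _
  have := Module.Flat.of_linearEquiv (coindUntwist G)
  refine ⟨Module.Flat.rTensor_exact _ exact_bot, ?_⟩
  exact Function.Exact.of_ladder_addEquiv_of_exact (e₁ := boxTopCoindEquiv M)
    (e₂ := boxTopCoindEquiv M') (e₃ := boxTopCoindEquiv M'')
    (f₁₂ := f.bot.toAddMonoidHom) (f₂₃ := g.bot.toAddMonoidHom)
    (AddMonoidHom.ext fun m => Mod.boxMapTop_boxTr f m _)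
    (AddMonoidHom.ext fun m => Mod.boxMapTop_boxTr g m _) exact_bot

end Flat

/-! ### Nakaoka spectra -/

namespace TIdeal

variable {R : CpTambara.{u} p}

theorem isPrime_of_le_iff {P : TIdeal R} {q : Ideal R.top} (hq : q.IsPrime)
    (h : ∀ I : TIdeal R, I ≤ P ↔ I.top ≤ q) : P.IsPrime where
  ne_top hP := hq.ne_top (top_le_iff.1 ((h ⊤).1 hP.ge))
  le_or_le I J hIJ := by
    rw [h, h]
    exact hq.mul_le.1 <| Ideal.mul_le.2 fun x hx y hy =>
      (h (I * J)).1 hIJ (subset_span_top ⟨x, hx, y, hy, rfl⟩)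

end TIdeal

namespace Spec

variable {R S : CpTambara.{u} p}

theorem specializes_of_le {P Q : Spec R} (h : P.1 ≤ Q.1) : P ⤳ Q := by
  rw [Specializes, TopologicalSpace.nhds_generateFrom, TopologicalSpace.nhds_generateFrom]
  refine biInf_mono fun U => ?_
  rintro ⟨hQ, I, rfl⟩
  exact ⟨fun hI => hQ (le_trans hI h), I, rfl⟩

theorem ker_le_map (f : Hom R S) (Q : Spec S) : f.ker ≤ (Spec.map f Q).1 :=
  ⟨fun _ ha => (congrArg (· ∈ Q.1.bot) ha).mpr Q.1.bot.zero_mem,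
    fun _ hx => (congrArg (· ∈ Q.1.top) hx).mpr Q.1.top.zero_mem⟩

theorem not_isOpenMap_map {f : Hom R S} {P : Spec R} (hP : ¬ f.ker ≤ P.1) {Q : Spec S}
    (hPQ : P.1 ≤ (Spec.map f Q).1) : ¬ IsOpenMap (Spec.map f) := by
  intro hf
  obtain ⟨Q', rfl⟩ : P ∈ Set.range (Spec.map f) :=
    (specializes_of_le hPQ).mem_open hf.isOpen_range ⟨Q, rfl⟩
  exact hP (ker_le_map f Q')

end Spec

section CoindIdeal

variable {A : Type u} [CommRing A]

/-- The Tambara ideal of the coinduction of `A` given by an ideal of `A`. -/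
def coindIdeal (p : ℕ) [Fact p.Prime] (I : Ideal A) : TIdeal (coind p A) where
  bot := Ideal.pi fun _ : Cp p => I
  top := I
  smul_mem g _ h := fun k => h (k * g)
  res_mem h := fun _ => h
  tr_mem h := I.sum_mem fun k _ => h k
  nm_mem h := I.prod_mem (Finset.mem_univ 1) (h 1)

theorem le_coindIdeal_iff {I : Ideal A} {J : TIdeal (coind p A)} :
    J ≤ coindIdeal p I ↔ J.top ≤ I := by
  refine ⟨And.right, fun h => ⟨fun F hF k => h ?_, h⟩⟩
  have apply_eq : F k = (coind p A).tr (coindSingle 1 * k • F) := by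
    rw [coindSingle_mul, tr_coindSingle, one_mul, coind_smul_apply, one_mul]
  rw [apply_eq]
  exact J.tr_mem (J.bot.mul_mem_left _ (J.smul_mem k hF))

theorem isPrime_coindIdeal {I : Ideal A} (hI : I.IsPrime) : (coindIdeal p I).IsPrime :=
  TIdeal.isPrime_of_le_iff hI fun _ => le_coindIdeal_iff

end CoindIdeal

section GhostIdeal

variable {R : CpTambara.{u} p}

theorem transferIdeal_eq_top_iff : R.transferIdeal = ⊤ ↔ Function.Surjective R.tr :=
  (Ideal.eq_top_iff_one _).trans
    ⟨fun ⟨a, _, ha⟩ x => ⟨a * R.res x, by rw [R.tr_mul_res, ha, one_mul]⟩,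
      fun h => (h 1).imp fun _ ha => ⟨trivial, ha⟩⟩

variable (R) in
/-- The norm modulo transfers, which is additive by Tambara reciprocity. -/
def geometricNorm : R.bot →+* R.top ⧸ R.transferIdeal where
  toFun a := Ideal.Quotient.mk R.transferIdeal (R.nm a)
  map_one' := by rw [map_one, map_one]
  map_mul' a b := by rw [map_mul, map_mul]
  map_zero' := by rw [R.nm_zero, map_zero]
  map_add' a b := by
    rw [R.nm_add, map_add, map_add, map_sum, add_eq_left]
    exact Finset.sum_eq_zero fun ω _ =>
      Ideal.Quotient.eq_zero_iff_mem.2 (R.tr_mem_transferIdeal _)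

variable {q : Ideal (R.top ⧸ R.transferIdeal)}

theorem smul_mem_comap_geometricNorm (g : Cp p) {a : R.bot} (h : a ∈ q.comap R.geometricNorm) :
    g • a ∈ q.comap R.geometricNorm :=
  (congrArg (Ideal.Quotient.mk R.transferIdeal · ∈ q) (R.nm_smul g a)).mpr h

variable (q) in
/-- The Tambara ideal of the ghost given by an ideal of the second factor of the level
`C_p/C_p`. -/
def ghostIdeal : TIdeal (ghost R) where
  bot := q.comap R.geometricNorm
  top := Ideal.prod ((q.comap R.geometricNorm).comap R.fixedPoints.subtype) q
  smul_mem g _ h := smul_mem_comap_geometricNorm g h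
  res_mem h := h.1
  tr_mem h := ⟨(q.comap R.geometricNorm).sum_mem fun g _ => smul_mem_comap_geometricNorm g h,
    q.zero_mem⟩
  nm_mem h := ⟨(q.comap R.geometricNorm).prod_mem (Finset.mem_univ 1)
    (smul_mem_comap_geometricNorm 1 h), h⟩

theorem le_ghostIdeal_iff {I : TIdeal (ghost R)} :
    I ≤ ghostIdeal q ↔ I.top ≤ q.comap (RingHom.snd R.fixedPoints _) := by
  refine ⟨fun h x hx => (h.2 hx).2, fun h => ?_⟩
  have bot_le : I.bot ≤ q.comap R.geometricNorm := fun a ha => h (I.nm_mem ha)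
  exact ⟨bot_le, fun x hx => ⟨bot_le (I.res_mem hx), h hx⟩⟩

theorem isPrime_ghostIdeal (hq : q.IsPrime) : (ghostIdeal q).IsPrime :=
  TIdeal.isPrime_of_le_iff (hq.comap _) fun _ => le_ghostIdeal_iff

theorem not_ker_ghostToCoind_le_ghostIdeal (hq : q ≠ ⊤) :
    ¬ (ghostToCoind R).ker ≤ ghostIdeal q := by
  intro h
  have zero_one_mem : ((0, 1) : (ghost R).top) ∈ (ghostToCoind R).ker.top :=
    map_zero (ghost R).res
  exact hq ((Ideal.eq_top_iff_one q).2 (h.2 zero_one_mem).2)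

theorem ghostIdeal_le_comap_coindIdeal :
    ghostIdeal q ≤ (coindIdeal p (q.comap R.geometricNorm)).comap (ghostToCoind R) :=
  ⟨fun _ ha k => smul_mem_comap_geometricNorm k ha, fun _ hx => hx.1⟩

theorem not_isOpenMap_map_ghostToCoind (hR : ¬ Function.Surjective R.tr) :
    ¬ IsOpenMap (Spec.map (ghostToCoind R)) := by
  have : Nontrivial (R.top ⧸ R.transferIdeal) :=
    Ideal.Quotient.nontrivial_iff.2 (mt transferIdeal_eq_top_iff.1 hR)
  obtain ⟨q, hq⟩ := Ideal.exists_maximal (R.top ⧸ R.transferIdeal)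
  let P : Spec (ghost R) := ⟨ghostIdeal q, isPrime_ghostIdeal hq.isPrime⟩
  let Q : Spec (coind p R.bot) :=
    ⟨coindIdeal p (q.comap R.geometricNorm), isPrime_coindIdeal (hq.isPrime.comap _)⟩
  exact Spec.not_isOpenMap_map (P := P) (Q := Q) (not_ker_ghostToCoind_le_ghostIdeal hq.ne_top)
    ghostIdeal_le_comap_coindIdeal

end GhostIdeal

theorem coindUnit_etale (G : CpTambara.{u} p) : (coindUnit G).Etale where
  finitelyPresented := coindUnit_finitelyPresented G
  flat := coindUnit_flat G
  kaehlerBot := subsingleton_kaehlerBot_of_ker_le (ker_boxSelfMul_coindUnit_le G)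
  kaehlerTop := subsingleton_kaehlerTop_of_ker_le (ker_boxSelfMul_coindUnit_le G)

end CpTambara

theorem mainTheorem3 (p : ℕ) [Fact p.Prime] (R : CpTambara.{u} p)
    (hR : ¬ Function.Surjective R.tr) :
    (CpTambara.ghostToCoind R).Etale ∧
      ¬ IsOpenMap (CpTambara.Spec.map (CpTambara.ghostToCoind R)) :=
  ⟨CpTambara.coindUnit_etale (CpTambara.ghost R), CpTambara.not_isOpenMap_map_ghostToCoind hR⟩
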